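/- **Corollary 1.5 (Approximation of marginals: no boundedness assumption).** Let $p>2$ and put $q=4p$. There is a polynomial $P_p$ in four variables with real coefficients, depending only on $p$, such that the following holds for all $K>0$, $L\ge 0$, $\varepsilon>0$ and $\delta>0$. Put $$C=P_p(K,L,1/\varepsilon,1/\delta).$$ Then $C>0$. Moreover, let $n,N$ be non-negative integers with $N\ge C\,n^{p/2}$, and let $X_1,\dots,X_N$ be independent (not necessarily identically distributed) random vectors in $\mathbb{R}^n$, defined on a common probability space, which satisfy $$\big(\mathbb{E}|\langle X_i,x\rangle|^q\big)^{1/q}\le L\qquad\text{for all } x\in S^{n-1},\ i=1,\dots,N .$$ Denote by $I$ the random set $\{\,i\le N:\ \|X_i\|_2\le K\sqrt n\,\}$. Then with probability at least $1-\delta$ one has $$\sup_{x\in S^{n-1}}\Big|\frac1N\sum_{i\in I}|\langle X_i,x\rangle|^p-\frac1N\sum_{i=1}^N\mathbb{E}|\langle X_i,x\rangle|^p\Big|\le \varepsilon+K^{p-q}L^q .$$ (For $n=0$ the sphere is empty and the supremum is $0$.) -/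

import Mathlib

open MeasureTheory ProbabilityTheory

noncomputable section

/-- The bound `(𝔼 |⟨X, x⟩| ^ q) ^ (1 / q) ≤ L` for all unit vectors `x`. Integrability is part of
the condition, so that the Bochner integral is the true (finite) moment. -/
def MarginalMomentBound {Ω : Type*} [MeasurableSpace Ω] (μ : Measure Ω) {n : ℕ}
    (X : Ω → EuclideanSpace ℝ (Fin n)) (q L : ℝ) : Prop :=
  ∀ x : EuclideanSpace ℝ (Fin n), ‖x‖ = 1 →
    Integrable (fun ω => |inner ℝ (X ω) x| ^ q) μ ∧
      (∫ ω, |inner ℝ (X ω) x| ^ q ∂μ) ^ (1 / q) ≤ L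

/-- The random index set `I = {i : ‖X i‖₂ ≤ K √n}` of the samples with moderate norm. -/
def moderateIndices {Ω : Type*} {n N : ℕ} (X : Fin N → Ω → EuclideanSpace ℝ (Fin n))
    (K : ℝ) (ω : Ω) : Finset (Fin N) :=
  Finset.univ.filter (fun i => ‖X i ω‖ ≤ K * √(n : ℝ))

/-- The supremum over the unit sphere of
`|(1/N) ∑_{i ∈ I} |⟨X i, x⟩| ^ p - (1/N) ∑_{i ≤ N} 𝔼 |⟨X i, x⟩| ^ p|`,
where `I` is the set of samples of norm at most `K √n`. It is taken in `[0, ∞]`, so that it is a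
true supremum. -/
def truncatedDeviation {Ω : Type*} [MeasurableSpace Ω] (μ : Measure Ω) {n N : ℕ}
    (X : Fin N → Ω → EuclideanSpace ℝ (Fin n)) (p K : ℝ) (ω : Ω) : ENNReal :=
  ⨆ x ∈ Metric.sphere (0 : EuclideanSpace ℝ (Fin n)) 1,
    ENNReal.ofReal
      |(1 / (N : ℝ)) * ∑ i ∈ moderateIndices X K ω, |inner ℝ (X i ω) x| ^ p
        - (1 / (N : ℝ)) * ∑ i, ∫ ω', |inner ℝ (X i ω') x| ^ p ∂μ|

end

/-! Replace each `X i` by `truncateNorm (K * √n) (X i)`, which is again independent, has norm at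
most `K √n` and marginal moments no larger. The empirical sum over `I` does not see the change,
while the mean `p`-th moment moves by at most `K ^ (p - q) * L ^ q`
(`abs_integral_truncateNorm_sub_le`); this is the whole deterministic error. It remains to treat
bounded vectors, for which one large parameter `W` dominates `K`, `L`, `1/ε` and `1/δ`. The
marginals are split at height `M`, a fixed power of `W`.

Large marginals. A moment of order `4p` and a union bound show that, with high probability and for
all `r`, no `r` of the vectors are all strongly correlated with the sum of fewer than `r` others
(`AlmostOrthogonal`). From any `2r - 1` indices one can then greedily pick `r` vectors with a short
sum; pairing that sum with `x` bounds their smallest marginal. So the `m`-th largest marginal is at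
most of order `(N/m) ^ (1/(2p)) + √(n/m)`, uniformly in `x` (`le_marginalDecay`). Taking `p`-th
powers and summing over the largest `k` gives `√(N k)` and `n ^ (p/2)`, the latter because `∑ m ^
(-p/2)` converges for `p > 2`. Few marginals exceed `M`, so after division by `N` both terms are
small once `N ≥ C n ^ (p/2)` (`abs_average_truncatedPower_sub_le`).

Small marginals. The power truncated at `M` is bounded and Lipschitz, so Hoeffding's inequality on a
net of the sphere controls it. The entropy `n log n` of the net is beaten by `N ≳ n ^ (p/2)`, again
since `p > 2` (`pow_mul_exp_neg_le`). The expectations lose little at height `M` because the moment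
of order `4p` is finite. -/

/-! ### Almost orthogonality of independent vectors -/

/-- Independent random vectors: given one index set, the probability that all the vectors of a
disjoint index set have a large inner product with the sum over the first one. -/
lemma measure_forall_lt_inner_sum_le {Ω ι : Type*} [MeasurableSpace Ω] {μ : Measure Ω}
    [IsProbabilityMeasure μ] {n : ℕ} {Y : ι → Ω → EuclideanSpace ℝ (Fin n)}
    (hY : ∀ i, Measurable (Y i)) (hind : iIndepFun Y μ) {s : ℝ} {τ : ENNReal}
    (hτ : ∀ i (w : EuclideanSpace ℝ (Fin n)), μ {ω | s * ‖w‖ < |inner ℝ (Y i ω) w|} ≤ τ)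
    {S F : Finset ι} (hSF : Disjoint S F) :
    μ {ω | ∀ i ∈ F, s * ‖∑ j ∈ S, Y j ω‖ < |inner ℝ (Y i ω) (∑ j ∈ S, Y j ω)|} ≤ τ ^ F.card := by
  classical
  let f : Ω → (S → EuclideanSpace ℝ (Fin n)) := fun ω j => Y j ω
  let g : Ω → (F → EuclideanSpace ℝ (Fin n)) := fun ω i => Y i ω
  have hf : Measurable f := measurable_pi_lambda _ fun j => hY j
  have hg : Measurable g := measurable_pi_lambda _ fun j => hY j
  have hmap := (hind.indepFun_finset S F hSF hY).map_prod_eq_prod_map_map hf.aemeasurable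
    hg.aemeasurable
  let D : Set ((S → EuclideanSpace ℝ (Fin n)) × (F → EuclideanSpace ℝ (Fin n))) :=
    {z | ∀ i : F, s * ‖∑ j, z.1 j‖ < |inner ℝ (z.2 i) (∑ j, z.1 j)|}
  have hD : MeasurableSet D := by
    have : D = ⋂ i : F, {z | s * ‖∑ j, z.1 j‖ < |inner ℝ (z.2 i) (∑ j, z.1 j)|} := by
      ext z; simp [D]
    rw [this]
    refine MeasurableSet.iInter fun i => ?_
    refine (isOpen_lt ?_ ?_).measurableSet <;> fun_prop
  have hset : {ω | ∀ i ∈ F, s * ‖∑ j ∈ S, Y j ω‖ < |inner ℝ (Y i ω) (∑ j ∈ S, Y j ω)|}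
      = (fun ω => (f ω, g ω)) ⁻¹' D := by
    ext ω
    have : ∑ j : S, f ω j = ∑ j ∈ S, Y j ω := Finset.sum_coe_sort S (fun j => Y j ω)
    simp only [Set.mem_ofPred_eq, Set.mem_preimage, D, this, Subtype.forall]
    rfl
  rw [hset, ← Measure.map_apply (hf.prodMk hg) hD]
  erw [hmap]
  rw [Measure.prod_apply hD]
  have hpm : IsProbabilityMeasure (μ.map f) := Measure.isProbabilityMeasure_map hf.aemeasurable
  -- With the sum over `S` frozen, the events for different `i ∈ F` are independent and each has
  -- probability at most `τ`.
  have key : ∀ w : S → EuclideanSpace ℝ (Fin n), μ.map g (Prod.mk w ⁻¹' D) ≤ τ ^ F.card := by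
    intro w
    rw [Measure.map_apply hg (measurable_prodMk_left hD)]
    have h1 : g ⁻¹' (Prod.mk w ⁻¹' D)
        = ⋂ i ∈ F, Y i ⁻¹' {v | s * ‖∑ j, w j‖ < |inner ℝ v (∑ j, w j)|} := by
      ext ω
      simp [D, g]
    rw [h1, hind.measure_inter_preimage_eq_mul F]
    · exact Finset.prod_le_pow_card _ _ _ fun i _ => hτ i _
    · intro i _
      refine (isOpen_lt ?_ ?_).measurableSet <;> fun_prop
  calc ∫⁻ w, μ.map g (Prod.mk w ⁻¹' D) ∂(μ.map f) ≤ ∫⁻ _, τ ^ F.card ∂(μ.map f) :=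
        lintegral_mono key
    _ = τ ^ F.card := by simp

/-- Weight each set by `(r/N) ^ S.card`: the total weight is `(1 + r/N) ^ N ≤ e ^ r`, and every set
counted has weight at least `(r/N) ^ r`. -/
lemma card_filter_card_le {N r : ℕ} (hr : 1 ≤ r) (hrN : r ≤ N) :
    (((Finset.univ : Finset (Finset (Fin N))).filter (fun S => S.card ≤ r)).card : ℝ)
      ≤ (Real.exp 1 * N / r) ^ r := by
  have hr0 : (0 : ℝ) < r := by exact_mod_cast hr
  have hN0 : (0 : ℝ) < N := by exact_mod_cast hr.trans hrN
  have hle : (r : ℝ) / N ≤ 1 := by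
    rw [div_le_one hN0]; exact_mod_cast hrN
  have hpos : 0 < (r : ℝ) / N := by positivity
  have h1 : (((Finset.univ : Finset (Finset (Fin N))).filter (fun S => S.card ≤ r)).card : ℝ)
      * ((r : ℝ) / N) ^ r ≤ (1 + (r : ℝ) / N) ^ N := by
    have h2 : ∑ S : Finset (Fin N), ((r : ℝ) / N) ^ S.card = (1 + (r : ℝ) / N) ^ N := by
      have := Finset.sum_pow_mul_eq_add_pow ((r : ℝ) / N) 1 (Finset.univ : Finset (Fin N))
      simp only [one_pow, mul_one, Finset.powerset_univ, Finset.card_univ, Fintype.card_fin] at this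
      rw [this, add_comm]
    rw [← h2, ← nsmul_eq_mul, ← Finset.sum_const]
    calc _ ≤ ∑ S ∈ (Finset.univ : Finset (Finset (Fin N))).filter (fun S => S.card ≤ r),
          ((r : ℝ) / N) ^ S.card := by
          refine Finset.sum_le_sum fun S hS => ?_
          exact pow_le_pow_of_le_one hpos.le hle (Finset.mem_filter.1 hS).2
      _ ≤ _ := Finset.sum_le_sum_of_subset_of_nonneg (Finset.filter_subset _ _)
          fun _ _ _ => by positivity
  have h3 : (1 + (r : ℝ) / N) ^ N ≤ Real.exp 1 ^ r := by
    calc (1 + (r : ℝ) / N) ^ N ≤ (Real.exp (r / N)) ^ N := by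
          refine pow_le_pow_left₀ (by positivity) ?_ _
          rw [add_comm]; exact Real.add_one_le_exp _
      _ = Real.exp 1 ^ r := by
          rw [← Real.exp_nat_mul, ← Real.exp_nat_mul]
          congr 1
          field_simp
  have h4 : (Real.exp 1 * N / r) ^ r = Real.exp 1 ^ r / ((r : ℝ) / N) ^ r := by
    rw [← div_pow]; congr 1; field_simp
  rw [h4, le_div_iff₀ (by positivity)]
  exact h1.trans h3

/-- Few of the vectors are far from orthogonal to a sum of few others. -/
def AlmostOrthogonal {n N : ℕ} (y : Fin N → EuclideanSpace ℝ (Fin n)) (r : ℕ) (s : ℝ) : Prop :=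
  ∀ S F : Finset (Fin N), Disjoint S F → S.card < r → F.card = r →
    ∃ i ∈ F, |inner ℝ (y i) (∑ j ∈ S, y j)| ≤ s * ‖∑ j ∈ S, y j‖

/-- A union bound over the pairs `(S, F)`: both sets have at most `r` elements, whence the square of
the counting factor. -/
lemma measureReal_not_almostOrthogonal_le {Ω : Type*} [MeasurableSpace Ω] {μ : Measure Ω}
    [IsProbabilityMeasure μ] {n N : ℕ} {Y : Fin N → Ω → EuclideanSpace ℝ (Fin n)}
    (hY : ∀ i, Measurable (Y i)) (hind : iIndepFun Y μ) {s τ : ℝ} (hτ0 : 0 ≤ τ)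
    (hτ : ∀ i (w : EuclideanSpace ℝ (Fin n)), μ.real {ω | s * ‖w‖ < |inner ℝ (Y i ω) w|} ≤ τ)
    {r : ℕ} (hr : 1 ≤ r) (hrN : r ≤ N) :
    μ.real {ω | ¬ AlmostOrthogonal (fun i => Y i ω) r s}
      ≤ ((Real.exp 1 * N / r) ^ 2 * τ) ^ r := by
  classical
  set A := (Finset.univ : Finset (Finset (Fin N))).filter (fun S => S.card ≤ r) with hA
  let B : Finset (Fin N) × Finset (Fin N) → Set Ω := fun z =>
    if Disjoint z.1 z.2 ∧ z.2.card = r then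
      {ω | ∀ i ∈ z.2, s * ‖∑ j ∈ z.1, Y j ω‖ < |inner ℝ (Y i ω) (∑ j ∈ z.1, Y j ω)|} else ∅
  have hB : ∀ z, μ.real (B z) ≤ τ ^ r := by
    intro z
    by_cases hz : Disjoint z.1 z.2 ∧ z.2.card = r
    · simp only [B, if_pos hz]
      have := measure_forall_lt_inner_sum_le hY hind (s := s) (τ := ENNReal.ofReal τ)
        (fun i w => by
          rw [← ENNReal.ofReal_toReal (measure_ne_top μ _)]
          exact ENNReal.ofReal_le_ofReal (hτ i w)) hz.1
      rw [hz.2, ← ENNReal.ofReal_pow hτ0] at this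
      exact ENNReal.toReal_le_of_le_ofReal (by positivity) this
    · simp only [B, if_neg hz]
      simpa using pow_nonneg hτ0 r
  have hsub : {ω | ¬ AlmostOrthogonal (fun i => Y i ω) r s} ⊆ ⋃ z ∈ A ×ˢ A, B z := by
    intro ω hω
    simp only [AlmostOrthogonal, Set.mem_ofPred_eq] at hω
    push Not at hω
    obtain ⟨S, F, hSF, hS, hF, h⟩ := hω
    simp only [Set.mem_iUnion]
    refine ⟨(S, F), by simp [A, hS.le, hF], ?_⟩
    simp only [B, if_pos (And.intro hSF hF)]
    exact h
  calc μ.real {ω | ¬ AlmostOrthogonal (fun i => Y i ω) r s} ≤ μ.real (⋃ z ∈ A ×ˢ A, B z) :=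
        measureReal_mono hsub (measure_ne_top _ _)
    _ ≤ ∑ z ∈ A ×ˢ A, μ.real (B z) := measureReal_biUnion_finset_le _ _
    _ ≤ ∑ z ∈ A ×ˢ A, τ ^ r := Finset.sum_le_sum fun z _ => hB z
    _ = (A.card : ℝ) ^ 2 * τ ^ r := by
        rw [Finset.sum_const, Finset.card_product, nsmul_eq_mul]; push_cast; ring
    _ ≤ ((Real.exp 1 * N / r) ^ r) ^ 2 * τ ^ r := by
        gcongr
        exact card_filter_card_le hr hrN
    _ = _ := by rw [mul_pow, ← pow_mul, ← pow_mul, mul_comm r 2]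

/-- Greedy selection inside a set of indices of almost orthogonal vectors. -/
lemma AlmostOrthogonal.exists_subset {n N : ℕ} {y : Fin N → EuclideanSpace ℝ (Fin n)} {r : ℕ}
    {s R : ℝ} (h : AlmostOrthogonal y r s) (hs : 0 ≤ s) (hR : 0 ≤ R) (hy : ∀ i, ‖y i‖ ≤ R)
    {E : Finset (Fin N)} (hE : 2 * r ≤ E.card + 1) :
    ∀ k ≤ r, ∃ S ⊆ E, S.card = k ∧ ‖∑ j ∈ S, y j‖ ≤ s * k + R * √k := by
  classical
  intro k
  induction k with
  | zero => intro _; exact ⟨∅, by simp, by simp, by simp⟩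
  | succ k ih =>
    intro hk
    obtain ⟨S, hSE, hSc, hS⟩ := ih (by omega)
    -- As `k ≤ r - 1` vectors have been used, at least `(2r - 1) - (r - 1) = r` indices of `E` are
    -- left.
    have hcard : r ≤ (E \ S).card := by
      rw [Finset.card_sdiff_of_subset hSE]; omega
    obtain ⟨F, hFE, hF⟩ := Finset.exists_subset_card_eq hcard
    have hdisj : Disjoint S F :=
      Finset.disjoint_of_subset_right hFE Finset.disjoint_sdiff
    obtain ⟨i, hiF, hi⟩ := h S F hdisj (by omega) hF
    have hiS : i ∉ S := fun hh => Finset.disjoint_left.1 hdisj hh hiF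
    refine ⟨insert i S, ?_, ?_, ?_⟩
    · exact Finset.insert_subset (Finset.sdiff_subset (hFE hiF)) hSE
    · rw [Finset.card_insert_of_notMem hiS, hSc]
    · rw [Finset.sum_insert hiS]
      set v := ∑ j ∈ S, y j
      refine le_of_sq_le_sq ?_ (by positivity)
      -- With `v` the old sum, the new squared norm is at most `‖v‖² + 2 s ‖v‖ + R² ≤ (‖v‖ + s)² +
      -- R²`, so the `s` parts add linearly and the `R` parts in quadrature.
      rw [norm_add_sq_real]
      have h1 : ‖y i‖ ^ 2 ≤ R ^ 2 := pow_le_pow_left₀ (norm_nonneg _) (hy i) 2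
      have h2 := (le_abs_self _).trans hi
      have hsq : √((k : ℝ)) ^ 2 = k := Real.sq_sqrt (by positivity)
      have hsq' : √((k + 1 : ℕ) : ℝ) ^ 2 = (k : ℝ) + 1 := by
        rw [Real.sq_sqrt (by positivity)]; push_cast; ring
      have hmono : √((k : ℝ)) ≤ √((k + 1 : ℕ) : ℝ) := Real.sqrt_le_sqrt (by push_cast; linarith)
      have hv : (‖v‖ + s) ^ 2 ≤ (s * (k + 1) + R * √(k : ℝ)) ^ 2 := by
        refine pow_le_pow_left₀ (by positivity) ?_ 2
        linarith
      have h3 : s * (k + 1) * (R * √(k : ℝ)) ≤ s * (k + 1) * (R * √((k + 1 : ℕ) : ℝ)) := by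
        gcongr
      push_cast at *
      nlinarith [sq_nonneg s, mul_pow R √(k : ℝ) 2, mul_pow R √((k : ℝ) + 1) 2]

/-- Among almost orthogonal vectors of bounded norm, few have a large inner product with a given
unit vector. -/
lemma AlmostOrthogonal.le_of_forall_le_inner {n N : ℕ} {y : Fin N → EuclideanSpace ℝ (Fin n)}
    {r : ℕ} {s R : ℝ} (h : AlmostOrthogonal y r s) (hr : 1 ≤ r) (hs : 0 ≤ s) (hR : 0 ≤ R)
    (hy : ∀ i, ‖y i‖ ≤ R) {E : Finset (Fin N)} (hE : 2 * r ≤ E.card + 1)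
    {x : EuclideanSpace ℝ (Fin n)} (hx : ‖x‖ = 1) {t : ℝ} (ht : ∀ i ∈ E, t ≤ inner ℝ (y i) x) :
    t ≤ s + R / √r := by
  obtain ⟨S, hSE, hSc, hS⟩ := h.exists_subset hs hR hy hE r le_rfl
  have hr0 : (0 : ℝ) < r := by exact_mod_cast hr
  have h1 : t * r ≤ ‖∑ j ∈ S, y j‖ := by
    calc t * r = ∑ i ∈ S, t := by rw [Finset.sum_const, hSc, nsmul_eq_mul, mul_comm]
      _ ≤ ∑ i ∈ S, inner ℝ (y i) x := Finset.sum_le_sum fun i hi => ht i (hSE hi)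
      _ = inner ℝ (∑ i ∈ S, y i) x := (sum_inner _ _ _).symm
      _ ≤ ‖∑ j ∈ S, y j‖ * ‖x‖ := real_inner_le_norm _ _
      _ = _ := by rw [hx, mul_one]
  have h2 : s * r + R * √r = (s + R / √r) * r := by
    have : (r : ℝ) = √r * √r := (Real.mul_self_sqrt hr0.le).symm
    have h0 : 0 < √(r : ℝ) := Real.sqrt_pos.2 hr0
    rw [add_mul]
    congr 1
    conv_rhs => rw [this]
    field_simp
    simp
  exact le_of_mul_le_mul_right ((h1.trans hS).trans_eq h2) hr0

/-! ### From ordered marginals to sums of powers -/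

/-- If the minimum of `a` over each nonempty subset of cardinality `m` is at most `c m`, then the
`m`-th largest value of `a` is at most `c m`. -/
lemma sum_le_sum_of_forall_subset {ι : Type*} {a : ι → ℝ} {c g : ℕ → ℝ} {φ : ℝ → ℝ}
    (hφ : MonotoneOn φ (Set.Ici 0)) (hg : ∀ m, 1 ≤ m → φ (c m) ≤ g m) (T : Finset ι)
    (ha : ∀ i ∈ T, 0 ≤ a i)
    (h : ∀ E ⊆ T, E.Nonempty → ∀ t, (∀ i ∈ E, t ≤ a i) → t ≤ c E.card) :
    ∑ i ∈ T, φ (a i) ≤ ∑ m ∈ Finset.Icc 1 T.card, g m := by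
  classical
  generalize hk : T.card = k
  induction k generalizing T with
  | zero => simp [Finset.card_eq_zero.1 hk]
  | succ k ih =>
    have hne : T.Nonempty := Finset.card_pos.1 (by omega)
    obtain ⟨i, hi, hmin⟩ := T.exists_min_image a hne
    rw [← Finset.add_sum_erase T _ hi, Finset.sum_Icc_succ_top (by omega), add_comm]
    have hle : a i ≤ c (k + 1) := hk ▸ h T subset_rfl hne _ hmin
    refine add_le_add ?_ ?_
    · refine ih (T.erase i) (fun j hj => ha j (Finset.mem_of_mem_erase hj))
        (fun E hE => h E (hE.trans (Finset.erase_subset _ _))) ?_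
      rw [Finset.card_erase_of_mem hi, hk]; rfl
    · exact (hφ (ha i hi) ((ha i hi).trans hle) hle).trans (hg _ (by omega))

lemma sum_Icc_inv_sqrt_le (k : ℕ) : ∑ m ∈ Finset.Icc 1 k, (√(m : ℝ))⁻¹ ≤ 2 * √(k : ℝ) := by
  induction k with
  | zero => simp
  | succ k ih =>
    rw [Finset.sum_Icc_succ_top (by omega)]
    have h0 : (0 : ℝ) < √((k + 1 : ℕ) : ℝ) := Real.sqrt_pos.2 (by positivity)
    have h1 : √((k + 1 : ℕ) : ℝ) ^ 2 = k + 1 := by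
      rw [Real.sq_sqrt (by positivity)]; push_cast; ring
    have h2 : √(k : ℝ) ^ 2 = k := Real.sq_sqrt (by positivity)
    have h3 : (√((k + 1 : ℕ) : ℝ))⁻¹ ≤ 2 * √((k + 1 : ℕ) : ℝ) - 2 * √(k : ℝ) := by
      rw [inv_le_iff_one_le_mul₀ h0]
      nlinarith [sq_nonneg (√((k + 1 : ℕ) : ℝ) - √(k : ℝ))]
    linarith

lemma sum_Icc_rpow_neg_le {a : ℝ} (ha : 1 < a) (k : ℕ) :
    ∑ m ∈ Finset.Icc 1 k, ((m : ℝ) ^ a)⁻¹ ≤ ∑' m : ℕ, ((m : ℝ) ^ a)⁻¹ :=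
  (Real.summable_nat_rpow_inv.2 ha).sum_le_tsum _ fun _ _ => by positivity

lemma add_rpow_le_two_rpow_mul {a b p : ℝ} (ha : 0 ≤ a) (hb : 0 ≤ b) (hp : 1 ≤ p) :
    (a + b) ^ p ≤ 2 ^ (p - 1) * (a ^ p + b ^ p) := by
  lift a to NNReal using ha
  lift b to NNReal using hb
  exact_mod_cast NNReal.rpow_add_le_mul_rpow_add_rpow a b hp

/-- The bound for the `m`-th largest of the marginals `⟨y i, x⟩`, for `N` vectors in dimension
`n`. -/
noncomputable def marginalDecay (p W : ℝ) (n N m : ℕ) : ℝ :=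
  W * (W ^ 3 * ((N : ℝ) / m) ^ 2) ^ (1 / (4 * p)) + W * √(2 * n / m)

lemma marginalDecay_rpow_le {p W : ℝ} (hp : 2 < p) (hW : 1 ≤ W) {n N m : ℕ} (hm : 1 ≤ m) :
    marginalDecay p W n N m ^ p
      ≤ 2 ^ p * W ^ p * (W * √(N : ℝ) * (√(m : ℝ))⁻¹)
        + 2 ^ p * W ^ p * ((2 * n) ^ (p / 2) * ((m : ℝ) ^ (p / 2))⁻¹) := by
  have hm0 : (0 : ℝ) < m := by exact_mod_cast hm
  have hW0 : 0 < W := by linarith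
  have hp0 : 0 < p := by linarith
  have h1 : marginalDecay p W n N m ^ p ≤ 2 ^ (p - 1) *
      ((W * (W ^ 3 * ((N : ℝ) / m) ^ 2) ^ (1 / (4 * p))) ^ p + (W * √(2 * n / m)) ^ p) :=
    add_rpow_le_two_rpow_mul (by positivity) (by positivity) (by linarith)
  have h2 : (W * (W ^ 3 * ((N : ℝ) / m) ^ 2) ^ (1 / (4 * p))) ^ p
      ≤ W ^ p * (W * √(N : ℝ) * (√(m : ℝ))⁻¹) := by
    rw [Real.mul_rpow hW0.le (by positivity), ← Real.rpow_mul (by positivity)]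
    refine mul_le_mul_of_nonneg_left ?_ (by positivity)
    -- The order `q = 4p` turns `(N/m)²` into `√(N/m)`, whose sum over `m` is harmless.
    have e : 1 / (4 * p) * p = 1 / 4 := by field_simp
    rw [e, Real.mul_rpow (by positivity) (by positivity), mul_assoc]
    refine mul_le_mul ?_ (le_of_eq ?_) (by positivity) (by positivity)
    · rw [← Real.rpow_natCast W 3, ← Real.rpow_mul hW0.le]
      calc W ^ (((3 : ℕ) : ℝ) * (1 / 4)) ≤ W ^ (1 : ℝ) :=
            Real.rpow_le_rpow_of_exponent_le hW (by norm_num)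
        _ = W := Real.rpow_one W
    · rw [← Real.rpow_natCast _ 2, ← Real.rpow_mul (by positivity), ← div_eq_mul_inv,
        ← Real.sqrt_div (by positivity), Real.sqrt_eq_rpow]
      norm_num
  have h3 : (W * √(2 * n / m)) ^ p = W ^ p * ((2 * n) ^ (p / 2) * ((m : ℝ) ^ (p / 2))⁻¹) := by
    rw [Real.mul_rpow hW0.le (by positivity), Real.sqrt_eq_rpow, ← Real.rpow_mul (by positivity),
      Real.div_rpow (by positivity) (by positivity), div_eq_mul_inv]
    congr 3 <;> ring_nf
  have h4 : (2 : ℝ) ^ (p - 1) ≤ 2 ^ p :=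
    Real.rpow_le_rpow_of_exponent_le (by norm_num) (by linarith)
  calc marginalDecay p W n N m ^ p ≤ _ := h1
    _ ≤ 2 ^ p * (W ^ p * (W * √(N : ℝ) * (√(m : ℝ))⁻¹)
          + W ^ p * ((2 * n) ^ (p / 2) * ((m : ℝ) ^ (p / 2))⁻¹)) := by
        rw [h3]
        gcongr
    _ = _ := by ring

section Tail

variable {n N : ℕ} {p W : ℝ} {y : Fin N → EuclideanSpace ℝ (Fin n)}
  {x : EuclideanSpace ℝ (Fin n)}

lemma le_marginalDecay (hp : 2 < p) (hW : 1 ≤ W)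
    (hy : ∀ r, 1 ≤ r → r ≤ N →
      AlmostOrthogonal y r (W * (W ^ 3 / 4 * ((N : ℝ) / r) ^ 2) ^ (1 / (4 * p))))
    (hyn : ∀ i, ‖y i‖ ≤ W * √(n : ℝ)) (hx : ‖x‖ = 1) {E : Finset (Fin N)} (hE : E.Nonempty)
    {t : ℝ} (ht : ∀ i ∈ E, t ≤ inner ℝ (y i) x) : t ≤ marginalDecay p W n N E.card := by
  have hW0 : 0 < W := by linarith
  have hcard : 1 ≤ E.card := hE.card_pos
  have hcN : E.card ≤ N := by simpa using E.card_le_univ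
  -- Half of `E`, rounded up: the largest `r` that the greedy selection allows. Passing from `r`
  -- back to `E.card ≤ 2r` absorbs the factor `1/4` and creates the `2` in `2n/m`.
  obtain ⟨r, hr⟩ : ∃ r, r = (E.card + 1) / 2 := ⟨_, rfl⟩
  have hr1 : 1 ≤ r := by omega
  have hr2 : (E.card : ℝ) ≤ 2 * r := by
    have : E.card ≤ 2 * r := by omega
    exact_mod_cast this
  have hr0 : (0 : ℝ) < r := by exact_mod_cast hr1
  have hc0 : (0 : ℝ) < E.card := by exact_mod_cast hcard
  refine ((hy r hr1 (by omega)).le_of_forall_le_inner hr1 (by positivity) (by positivity) hyn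
    (E := E) (by omega) hx ht).trans ?_
  unfold marginalDecay
  refine add_le_add ?_ ?_
  · refine mul_le_mul_of_nonneg_left ?_ hW0.le
    refine Real.rpow_le_rpow (by positivity) ?_ (by positivity)
    have : (N : ℝ) / r ≤ 2 * (N / E.card) := by
      rw [mul_div_assoc', div_le_div_iff₀ hr0 hc0]
      nlinarith [Nat.cast_nonneg (α := ℝ) N]
    calc W ^ 3 / 4 * ((N : ℝ) / r) ^ 2 ≤ W ^ 3 / 4 * (2 * (N / E.card)) ^ 2 := by gcongr
      _ = _ := by ring
  · rw [mul_div_assoc, ← Real.sqrt_div (by positivity)]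
    refine mul_le_mul_of_nonneg_left (Real.sqrt_le_sqrt ?_) hW0.le
    rw [div_le_div_iff₀ hr0 hc0]
    nlinarith [Nat.cast_nonneg (α := ℝ) n]

/-- The contribution of the large marginals to the sum of the `p`-th powers. -/
lemma sum_rpow_inner_le (hp : 2 < p) (hW : 1 ≤ W)
    (hy : ∀ r, 1 ≤ r → r ≤ N →
      AlmostOrthogonal y r (W * (W ^ 3 / 4 * ((N : ℝ) / r) ^ 2) ^ (1 / (4 * p))))
    (hyn : ∀ i, ‖y i‖ ≤ W * √(n : ℝ)) (hx : ‖x‖ = 1) {T : Finset (Fin N)}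
    (hT : ∀ i ∈ T, 0 ≤ inner ℝ (y i) x) :
    ∑ i ∈ T, (inner ℝ (y i) x) ^ p ≤ 2 ^ p * W ^ p * (2 * W * √(N : ℝ) * √(T.card : ℝ)
      + (2 * n) ^ (p / 2) * ∑' m : ℕ, ((m : ℝ) ^ (p / 2))⁻¹) := by
  have h := sum_le_sum_of_forall_subset (a := fun i => inner ℝ (y i) x)
    (c := marginalDecay p W n N) (φ := fun t => t ^ p)
    (fun a ha b _ hab => Real.rpow_le_rpow ha hab (by linarith))
    (fun m hm => marginalDecay_rpow_le hp hW hm) T hT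
    (fun E _ hne t ht => le_marginalDecay hp hW hy hyn hx hne ht)
  refine h.trans ?_
  have hW0 : 0 < W := by linarith
  rw [Finset.sum_add_distrib, ← Finset.mul_sum, ← Finset.mul_sum, ← Finset.mul_sum,
    ← Finset.mul_sum, ← mul_add]
  refine mul_le_mul_of_nonneg_left (add_le_add ?_ ?_) (by positivity)
  · calc W * √(N : ℝ) * ∑ m ∈ Finset.Icc 1 T.card, (√(m : ℝ))⁻¹
        ≤ W * √(N : ℝ) * (2 * √(T.card : ℝ)) := by
          gcongr; exact sum_Icc_inv_sqrt_le _
      _ = _ := by ring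
  · gcongr
    exact sum_Icc_rpow_neg_le (by linarith) _

end Tail

/-! ### Uniform deviation of bounded Lipschitz functions -/

/-- A finite net of the unit sphere that comes from a grid. -/
lemma exists_sphere_net (n : ℕ) {k : ℕ} (hk : 1 ≤ k) :
    ∃ A : Finset (EuclideanSpace ℝ (Fin n)), A.card ≤ (2 * k + 1) ^ n ∧ (∀ a ∈ A, ‖a‖ = 1) ∧
      ∀ x : EuclideanSpace ℝ (Fin n), ‖x‖ = 1 → ∃ a ∈ A, ‖x - a‖ ≤ √(n : ℝ) / k := by
  classical
  have hk0 : (0 : ℝ) < k := by exact_mod_cast hk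
  let G : Finset (Fin n → ℤ) := Fintype.piFinset fun _ => Finset.Icc (-(k : ℤ)) k
  let fl : EuclideanSpace ℝ (Fin n) → (Fin n → ℤ) := fun x i => ⌊k * x i⌋
  have hfl : ∀ x, ‖x‖ = 1 → fl x ∈ G := by
    intro x hx
    simp only [G, Fintype.mem_piFinset, Finset.mem_Icc, fl]
    intro i
    have h1 : |x i| ≤ 1 := by
      rw [← hx, ← Real.norm_eq_abs]; exact PiLp.norm_apply_le x i
    obtain ⟨h2, h3⟩ := abs_le.1 h1
    constructor
    · rw [Int.le_floor]; push_cast; nlinarith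
    · have : (⌊(k : ℝ) * x i⌋ : ℝ) ≤ k := (Int.floor_le _).trans (by nlinarith)
      exact_mod_cast this
  -- One unit vector is chosen in each grid cell that meets the sphere, so that the net lies on the
  -- sphere itself.
  let pick : (Fin n → ℤ) → EuclideanSpace ℝ (Fin n) := fun g =>
    if h : ∃ x, ‖x‖ = 1 ∧ fl x = g then h.choose else 0
  refine ⟨(G.image pick).filter fun a => ‖a‖ = 1, ?_, by simp, ?_⟩
  · refine (Finset.card_filter_le _ _).trans (Finset.card_image_le.trans ?_)
    simp only [G, Fintype.card_piFinset, Int.card_Icc, Finset.prod_const, Finset.card_univ,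
      Fintype.card_fin]
    apply le_of_eq
    congr 1
    omega
  · intro x hx
    have hex : ∃ z, ‖z‖ = 1 ∧ fl z = fl x := ⟨x, hx, rfl⟩
    have hp : pick (fl x) = hex.choose := dif_pos hex
    obtain ⟨h1, h2⟩ := hex.choose_spec
    rw [← hp] at h1 h2
    refine ⟨pick (fl x), Finset.mem_filter.2 ⟨Finset.mem_image_of_mem _ (hfl x hx), h1⟩, ?_⟩
    set a := pick (fl x)
    have hc : ∀ i, ((x - a) i) ^ 2 ≤ (1 / (k : ℝ)) ^ 2 := by
      intro i
      have h3 : ⌊(k : ℝ) * a i⌋ = ⌊(k : ℝ) * x i⌋ := congrFun h2 i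
      have h4 := Int.abs_sub_lt_one_of_floor_eq_floor h3.symm
      rw [← mul_sub, abs_mul, abs_of_pos hk0] at h4
      rw [← sq_abs]
      refine pow_le_pow_left₀ (abs_nonneg _) ?_ 2
      rw [le_div_iff₀ hk0, mul_comm]
      simpa using h4.le
    rw [EuclideanSpace.norm_eq, Real.sqrt_le_left (by positivity)]
    calc ∑ i, ‖(x - a) i‖ ^ 2 ≤ ∑ _i : Fin n, (1 / (k : ℝ)) ^ 2 :=
          Finset.sum_le_sum fun i _ => by simpa using hc i
      _ = (√(n : ℝ) / k) ^ 2 := by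
          rw [div_pow (√(n : ℝ)), Real.sq_sqrt (by positivity)]
          simp [div_eq_mul_inv]

/-- Hoeffding's inequality, two-sided, for averages of variables with values in `[0, B]`. -/
lemma measureReal_abs_average_sub_ge_le {Ω : Type*} [MeasurableSpace Ω] {μ : Measure Ω}
    [IsProbabilityMeasure μ] {N : ℕ} {Z : Fin N → Ω → ℝ} (hN : 1 ≤ N) (hZ : ∀ i, Measurable (Z i))
    (hind : iIndepFun Z μ) {B : ℝ} (hB0 : 0 < B) (hB : ∀ i ω, Z i ω ∈ Set.Icc 0 B) {u : ℝ}
    (hu : 0 ≤ u) :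
    μ.real {ω | u ≤ |(1 / (N : ℝ)) * ∑ i, Z i ω - (1 / (N : ℝ)) * ∑ i, ∫ ω', Z i ω' ∂μ|}
      ≤ 2 * Real.exp (-(2 * N * u ^ 2 / B ^ 2)) := by
  have hN0 : (0 : ℝ) < N := by exact_mod_cast hN
  let V : Fin N → Ω → ℝ := fun i ω => Z i ω - ∫ ω', Z i ω' ∂μ
  have hV : ∀ i, HasSubgaussianMGF (V i) ((‖B - 0‖₊ / 2) ^ 2) μ := fun i =>
    hasSubgaussianMGF_of_mem_Icc (hZ i).aemeasurable (ae_of_all _ (hB i))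
  have hVind : iIndepFun V μ :=
    hind.comp (fun i z => z - ∫ ω', Z i ω' ∂μ) fun i => measurable_id.sub_const _
  have hVind' : iIndepFun (fun i => -V i) μ :=
    hVind.comp (fun _ z => -z) fun _ => measurable_neg
  have hε : 0 ≤ N * u := by positivity
  have h1 := HasSubgaussianMGF.measure_sum_ge_le_of_iIndepFun hVind (s := Finset.univ)
    (fun i _ => hV i) hε
  have h2 := HasSubgaussianMGF.measure_sum_ge_le_of_iIndepFun hVind' (s := Finset.univ)
    (fun i _ => (hV i).neg) hε
  have hexp : -(N * u) ^ 2 / (2 * ((∑ _i : Fin N, (‖B - 0‖₊ / 2) ^ 2 : NNReal) : ℝ))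
      = -(2 * N * u ^ 2 / B ^ 2) := by
    simp only [sub_zero, Finset.sum_const, Finset.card_univ, Fintype.card_fin, nsmul_eq_mul]
    push_cast
    rw [Real.norm_of_nonneg hB0.le]
    field_simp
  push_cast at h1 h2 hexp
  rw [hexp] at h1 h2
  have hsub : {ω | u ≤ |(1 / (N : ℝ)) * ∑ i, Z i ω - (1 / (N : ℝ)) * ∑ i, ∫ ω', Z i ω' ∂μ|}
      ⊆ {ω | N * u ≤ ∑ i, V i ω} ∪ {ω | N * u ≤ ∑ i, (-V i) ω} := by
    intro ω hω
    have hω' : u ≤ |(1 / (N : ℝ)) * ∑ i, V i ω| := by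
      simp only [V, Finset.sum_sub_distrib, mul_sub]
      exact hω
    rw [abs_mul, abs_of_pos (by positivity : (0 : ℝ) < 1 / N), one_div, ← div_eq_inv_mul,
      le_div_iff₀ hN0, mul_comm] at hω'
    rcases le_abs'.1 hω' with h | h
    · right
      simp only [Set.mem_ofPred_eq, Pi.neg_apply, Finset.sum_neg_distrib]
      linarith
    · left; exact h
  calc _ ≤ μ.real ({ω | N * u ≤ ∑ i, V i ω} ∪ {ω | N * u ≤ ∑ i, (-V i) ω}) :=
        measureReal_mono hsub (measure_ne_top _ _)
    _ ≤ _ := measureReal_union_le _ _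
    _ ≤ _ := by linarith

lemma abs_one_div_mul_sum_le {N : ℕ} (hN : 1 ≤ N) {c : Fin N → ℝ} {b : ℝ}
    (hc : ∀ i, |c i| ≤ b) :
    |(1 / (N : ℝ)) * ∑ i, c i| ≤ b := by
  have hN0 : (0 : ℝ) < N := by exact_mod_cast hN
  rw [abs_mul, abs_of_pos (by positivity : (0 : ℝ) < 1 / N), one_div, ← div_eq_inv_mul,
    div_le_iff₀ hN0]
  refine (Finset.abs_sum_le_sum_abs _ _).trans ((Finset.sum_le_sum fun i _ => hc i).trans ?_)
  simp [mul_comm]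

/-- Uniform deviation over the sphere of a bounded Lipschitz function of the marginals of bounded
independent random vectors. -/
lemma measureReal_exists_deviation_le {Ω : Type*} [MeasurableSpace Ω] {μ : Measure Ω}
    [IsProbabilityMeasure μ] {n N : ℕ} {Y : Fin N → Ω → EuclideanSpace ℝ (Fin n)} (hN : 1 ≤ N)
    (hY : ∀ i, Measurable (Y i)) (hind : iIndepFun Y μ) {R : ℝ} (hR : ∀ i ω, ‖Y i ω‖ ≤ R)
    {φ : ℝ → ℝ} (hφ : Measurable φ) {B Λ : ℝ} (hB0 : 0 < B) (hB : ∀ t, φ t ∈ Set.Icc 0 B)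
    (hΛ0 : 0 ≤ Λ) (hΛ : ∀ s t, |φ s - φ t| ≤ Λ * |s - t|) {u : ℝ} (hu : 0 ≤ u) {k : ℕ}
    (hk : 1 ≤ k) :
    μ.real {ω | ∃ x : EuclideanSpace ℝ (Fin n), ‖x‖ = 1 ∧
        u + 2 * (Λ * (R * (√(n : ℝ) / k))) ≤ |(1 / (N : ℝ)) * ∑ i, φ (inner ℝ (Y i ω) x)
          - (1 / (N : ℝ)) * ∑ i, ∫ ω', φ (inner ℝ (Y i ω') x) ∂μ|}
      ≤ (2 * k + 1) ^ n * (2 * Real.exp (-(2 * N * u ^ 2 / B ^ 2))) := by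
  obtain ⟨A, hAc, hA1, hA⟩ := exists_sphere_net n hk
  let i0 : Fin N := ⟨0, hN⟩
  have hmeas : ∀ i (x : EuclideanSpace ℝ (Fin n)),
      Measurable fun ω => φ (inner ℝ (Y i ω) x) := fun i x =>
    hφ.comp ((hY i).inner_const)
  have hint : ∀ i (x : EuclideanSpace ℝ (Fin n)),
      Integrable (fun ω => φ (inner ℝ (Y i ω) x)) μ := fun i x =>
    Integrable.of_mem_Icc 0 B (hmeas i x).aemeasurable (ae_of_all _ fun ω => hB _)
  set D : EuclideanSpace ℝ (Fin n) → Ω → ℝ := fun x ω =>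
    (1 / (N : ℝ)) * ∑ i, φ (inner ℝ (Y i ω) x)
      - (1 / (N : ℝ)) * ∑ i, ∫ ω', φ (inner ℝ (Y i ω') x) ∂μ with hD
  have hsub : {ω | ∃ x : EuclideanSpace ℝ (Fin n), ‖x‖ = 1 ∧
        u + 2 * (Λ * (R * (√(n : ℝ) / k))) ≤ |D x ω|} ⊆ ⋃ a ∈ A, {ω | u ≤ |D a ω|} := by
    rintro ω ⟨x, hx, hω⟩
    obtain ⟨a, haA, hxa⟩ := hA x hx
    have hR0 : 0 ≤ R := (norm_nonneg _).trans (hR i0 ω)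
    have hpt : ∀ i ω, |φ (inner ℝ (Y i ω) x) - φ (inner ℝ (Y i ω) a)|
        ≤ Λ * (R * (√(n : ℝ) / k)) := by
      intro i ω
      refine (hΛ _ _).trans (mul_le_mul_of_nonneg_left ?_ hΛ0)
      rw [← inner_sub_right]
      exact (abs_real_inner_le_norm _ _).trans
        (mul_le_mul (hR i ω) hxa (norm_nonneg _) hR0)
    have h1 := abs_one_div_mul_sum_le hN
      (c := fun i => φ (inner ℝ (Y i ω) x) - φ (inner ℝ (Y i ω) a)) fun i => hpt i ω
    have h2 := abs_one_div_mul_sum_le hN (c := fun i => ∫ ω', φ (inner ℝ (Y i ω') x) ∂μ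
        - ∫ ω', φ (inner ℝ (Y i ω') a) ∂μ) (by
      intro i
      rw [← integral_sub (hint i x) (hint i a)]
      have := norm_integral_le_of_norm_le_const (μ := μ)
        (f := fun ω' => φ (inner ℝ (Y i ω') x) - φ (inner ℝ (Y i ω') a))
        (ae_of_all _ fun ω' => hpt i ω')
      simpa using this)
    simp only [Finset.sum_sub_distrib, mul_sub] at h1 h2
    simp only [Set.mem_iUnion]
    refine ⟨a, haA, ?_⟩
    have h3 : |D x ω| ≤ |D a ω| + 2 * (Λ * (R * (√(n : ℝ) / k))) := by
      have : D x ω = D a ω + ((1 / (N : ℝ)) * ∑ i, φ (inner ℝ (Y i ω) x)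
          - (1 / (N : ℝ)) * ∑ i, φ (inner ℝ (Y i ω) a))
          - ((1 / (N : ℝ)) * ∑ i, ∫ ω', φ (inner ℝ (Y i ω') x) ∂μ
            - (1 / (N : ℝ)) * ∑ i, ∫ ω', φ (inner ℝ (Y i ω') a) ∂μ) := by
        simp only [hD]; ring
      rw [this]
      refine (abs_sub _ _).trans ?_
      have := abs_add_le (D a ω) ((1 / (N : ℝ)) * ∑ i, φ (inner ℝ (Y i ω) x)
          - (1 / (N : ℝ)) * ∑ i, φ (inner ℝ (Y i ω) a))
      linarith
    change u ≤ |D a ω|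
    linarith
  calc _ ≤ μ.real (⋃ a ∈ A, {ω | u ≤ |D a ω|}) := measureReal_mono hsub (measure_ne_top _ _)
    _ ≤ ∑ a ∈ A, μ.real {ω | u ≤ |D a ω|} := measureReal_biUnion_finset_le _ _
    _ ≤ ∑ a ∈ A, 2 * Real.exp (-(2 * N * u ^ 2 / B ^ 2)) := by
        refine Finset.sum_le_sum fun a _ => ?_
        exact measureReal_abs_average_sub_ge_le hN (fun i => hmeas i a)
          (hind.comp (fun _ v => φ (inner ℝ v a)) fun _ => hφ.comp (by fun_prop)) hB0
          (fun i ω => hB _) hu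
    _ = (A.card : ℝ) * (2 * Real.exp (-(2 * N * u ^ 2 / B ^ 2))) := by
        rw [Finset.sum_const, nsmul_eq_mul]
    _ ≤ _ := by
        gcongr
        exact_mod_cast hAc

/-! ### Truncated powers -/

lemma abs_rpow_sub_rpow_le {p M : ℝ} (hp : 1 ≤ p) {a b : ℝ}
    (ha : a ∈ Set.Icc 0 M) (hb : b ∈ Set.Icc 0 M) :
    |a ^ p - b ^ p| ≤ p * M ^ (p - 1) * |a - b| := by
  have := (convex_Icc (0 : ℝ) M).norm_image_sub_le_of_norm_hasDerivWithin_le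
    (f := fun t => t ^ p) (f' := fun t => p * t ^ (p - 1)) (C := p * M ^ (p - 1))
    (fun t _ => (Real.hasDerivAt_rpow_const (Or.inr hp)).hasDerivWithinAt)
    (fun t ht => by
      rw [Real.norm_of_nonneg (by have := Real.rpow_nonneg ht.1 (p - 1); positivity)]
      have := Real.rpow_le_rpow ht.1 ht.2 (by linarith : 0 ≤ p - 1)
      gcongr) hb ha
  simpa using this

/-- The `p`-th power of the absolute value, truncated at height `M ^ p`. -/
noncomputable def truncatedPower (p M t : ℝ) : ℝ := min |t| M ^ p

lemma measurable_truncatedPower (p M : ℝ) : Measurable (truncatedPower p M) := by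
  unfold truncatedPower; fun_prop

lemma truncatedPower_mem_Icc {p M : ℝ} (hp : 0 ≤ p) (hM : 0 ≤ M) (t : ℝ) :
    truncatedPower p M t ∈ Set.Icc 0 (M ^ p) :=
  ⟨Real.rpow_nonneg (le_min (abs_nonneg _) hM) _,
    Real.rpow_le_rpow (le_min (abs_nonneg _) hM) (min_le_right _ _) hp⟩

lemma abs_truncatedPower_sub_le {p M : ℝ} (hp : 1 ≤ p) (hM : 0 ≤ M) (s t : ℝ) :
    |truncatedPower p M s - truncatedPower p M t| ≤ p * M ^ (p - 1) * |s - t| := by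
  refine (abs_rpow_sub_rpow_le hp ⟨le_min (abs_nonneg _) hM, min_le_right _ _⟩
    ⟨le_min (abs_nonneg _) hM, min_le_right _ _⟩).trans ?_
  refine mul_le_mul_of_nonneg_left ?_ (by have := Real.rpow_nonneg hM (p - 1); positivity)
  refine (abs_min_sub_min_le_max _ _ _ _).trans ?_
  simpa using abs_abs_sub_abs_le s t

lemma truncatedPower_of_le {p M t : ℝ} (h : |t| ≤ M) : truncatedPower p M t = |t| ^ p := by
  rw [truncatedPower, min_eq_left h]

lemma truncatedPower_le {p M : ℝ} (hp : 0 ≤ p) (hM : 0 ≤ M) (t : ℝ) :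
    truncatedPower p M t ≤ |t| ^ p :=
  Real.rpow_le_rpow (le_min (abs_nonneg _) hM) (min_le_left _ _) hp

/-! ### Moments and the cost of truncation -/

section Moments

variable {Ω : Type*} [MeasurableSpace Ω] {μ : Measure Ω} {n : ℕ}
  {X : Ω → EuclideanSpace ℝ (Fin n)} {p q L : ℝ}

lemma MarginalMomentBound.integral_le (h : MarginalMomentBound μ X q L) (hq : 0 < q)
    {x : EuclideanSpace ℝ (Fin n)} (hx : ‖x‖ = 1) :
    ∫ ω, |inner ℝ (X ω) x| ^ q ∂μ ≤ L ^ q := by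
  have h0 : 0 ≤ ∫ ω, |inner ℝ (X ω) x| ^ q ∂μ := integral_nonneg fun ω => by positivity
  calc ∫ ω, |inner ℝ (X ω) x| ^ q ∂μ = ((∫ ω, |inner ℝ (X ω) x| ^ q ∂μ) ^ (1 / q)) ^ q := by
        rw [← Real.rpow_mul h0, one_div_mul_cancel hq.ne', Real.rpow_one]
    _ ≤ L ^ q := Real.rpow_le_rpow (by positivity) (h x hx).2 hq.le

lemma MarginalMomentBound.mono {L' : ℝ} (h : MarginalMomentBound μ X q L) (hL : L ≤ L') :
    MarginalMomentBound μ X q L' :=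
  fun x hx => ⟨(h x hx).1, (h x hx).2.trans hL⟩

lemma MarginalMomentBound.measureReal_lt_inner_le [IsProbabilityMeasure μ]
    (h : MarginalMomentBound μ X q L) (hq : 0 < q) (hL : 0 ≤ L) {s : ℝ} (hs : 0 < s)
    (w : EuclideanSpace ℝ (Fin n)) :
    μ.real {ω | s * ‖w‖ < |inner ℝ (X ω) w|} ≤ (L / s) ^ q := by
  by_cases hw : w = 0
  · simp only [hw, norm_zero, mul_zero, inner_zero_right, abs_zero, lt_self_iff_false,
      Set.ofPred_false, measureReal_empty]
    positivity
  have hw0 : 0 < ‖w‖ := norm_pos_iff.2 hw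
  have hx : ‖(‖w‖⁻¹ • w)‖ = 1 := by
    rw [norm_smul, norm_inv, norm_norm, inv_mul_cancel₀ hw0.ne']
  have h1 := mul_meas_ge_le_integral_of_nonneg (μ := μ)
    (ae_of_all _ fun ω => Real.rpow_nonneg (abs_nonneg (inner ℝ (X ω) (‖w‖⁻¹ • w))) q)
    (h _ hx).1 (s ^ q)
  have h2 : {ω | s * ‖w‖ < |inner ℝ (X ω) w|}
      ⊆ {ω | s ^ q ≤ |inner ℝ (X ω) (‖w‖⁻¹ • w)| ^ q} := by
    intro ω hω
    refine Real.rpow_le_rpow hs.le ?_ hq.le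
    rw [real_inner_smul_right, abs_mul, abs_of_pos (by positivity : 0 < ‖w‖⁻¹), ← div_eq_inv_mul,
      le_div_iff₀ hw0]
    exact le_of_lt hω
  rw [Real.div_rpow hL hs.le, le_div_iff₀ (by positivity), mul_comm]
  calc s ^ q * μ.real {ω | s * ‖w‖ < |inner ℝ (X ω) w|}
      ≤ s ^ q * μ.real {ω | s ^ q ≤ |inner ℝ (X ω) (‖w‖⁻¹ • w)| ^ q} := by
        gcongr
        exact measure_ne_top _ _
    _ ≤ _ := h1
    _ ≤ L ^ q := h.integral_le hq hx

lemma rpow_le_one_add_rpow {a : ℝ} (ha : 0 ≤ a) (hp : 0 ≤ p) (hpq : p ≤ q) :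
    a ^ p ≤ 1 + a ^ q := by
  have := Real.rpow_nonneg ha q
  rcases le_total a 1 with h | h
  · linarith [Real.rpow_le_one ha h hp]
  · linarith [Real.rpow_le_rpow_of_exponent_le h hpq]

lemma MarginalMomentBound.integrable_rpow [IsProbabilityMeasure μ]
    (h : MarginalMomentBound μ X q L) (hX : Measurable X) (hp : 0 ≤ p) (hpq : p ≤ q)
    {x : EuclideanSpace ℝ (Fin n)} (hx : ‖x‖ = 1) :
    Integrable (fun ω => |inner ℝ (X ω) x| ^ p) μ := by
  refine ((integrable_const (1 : ℝ)).add (h x hx).1).mono' ?_ (ae_of_all _ fun ω => ?_)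
  · have : Measurable fun ω => inner ℝ (X ω) x := hX.inner_const
    exact (this.abs.pow_const p).aestronglyMeasurable
  · rw [Real.norm_of_nonneg (by positivity)]
    exact rpow_le_one_add_rpow (abs_nonneg _) hp hpq

/-- Above height `M`, the factor `|t| ^ (p - q)` is at most `M ^ (p - q)` because the exponent is
nonpositive. -/
lemma abs_rpow_sub_truncatedPower_le {M : ℝ} (hM : 0 < M) (hpq : p ≤ q) (t : ℝ) :
    |t| ^ p - truncatedPower p M t ≤ |t| ^ q * M ^ (p - q) := by
  rcases le_or_gt |t| M with h | h
  · rw [truncatedPower_of_le h, sub_self]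
    positivity
  · have ht : 0 < |t| := hM.trans h
    have h1 : |t| ^ p = |t| ^ q * |t| ^ (p - q) := by
      rw [← Real.rpow_add ht]; congr 1; ring
    have h2 : |t| ^ (p - q) ≤ M ^ (p - q) :=
      Real.rpow_le_rpow_of_nonpos hM h.le (by linarith)
    have h3 : 0 ≤ truncatedPower p M t := Real.rpow_nonneg (le_min (abs_nonneg _) hM.le) _
    have h4 := mul_le_mul_of_nonneg_left h2 (Real.rpow_nonneg ht.le q)
    linarith

lemma integrable_truncatedPower_inner [IsProbabilityMeasure μ] (hX : Measurable X) {M : ℝ}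
    (hp : 0 ≤ p) (hM : 0 ≤ M) (x : EuclideanSpace ℝ (Fin n)) :
    Integrable (fun ω => truncatedPower p M (inner ℝ (X ω) x)) μ :=
  Integrable.of_mem_Icc 0 (M ^ p)
    ((measurable_truncatedPower p M).comp hX.inner_const).aemeasurable
    (ae_of_all _ fun _ => truncatedPower_mem_Icc hp hM _)

lemma MarginalMomentBound.abs_integral_truncatedPower_sub_le [IsProbabilityMeasure μ]
    (h : MarginalMomentBound μ X q L) (hX : Measurable X) (hp : 0 < p) (hpq : p ≤ q) {M : ℝ}
    (hM : 0 < M) {x : EuclideanSpace ℝ (Fin n)} (hx : ‖x‖ = 1) :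
    |∫ ω, truncatedPower p M (inner ℝ (X ω) x) ∂μ - ∫ ω, |inner ℝ (X ω) x| ^ p ∂μ|
      ≤ L ^ q * M ^ (p - q) := by
  have hi := h.integrable_rpow hX hp.le hpq hx
  have hi' := integrable_truncatedPower_inner (μ := μ) hX hp.le hM.le x
  rw [abs_sub_comm, ← integral_sub hi hi', abs_of_nonneg (integral_nonneg fun ω =>
    sub_nonneg.2 (truncatedPower_le hp.le hM.le _))]
  calc _ ≤ ∫ ω, |inner ℝ (X ω) x| ^ q * M ^ (p - q) ∂μ :=
        integral_mono (hi.sub hi') ((h x hx).1.mul_const _)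
          fun ω => abs_rpow_sub_truncatedPower_le hM hpq _
    _ = (∫ ω, |inner ℝ (X ω) x| ^ q ∂μ) * M ^ (p - q) := integral_mul_const _ _
    _ ≤ _ := by
        gcongr
        exact h.integral_le (hp.trans_le hpq) hx

/-- The vector `v` if its norm is at most `R`, and `0` otherwise. -/
noncomputable def truncateNorm (R : ℝ) (v : EuclideanSpace ℝ (Fin n)) :
    EuclideanSpace ℝ (Fin n) :=
  open Classical in if ‖v‖ ≤ R then v else 0

lemma measurable_truncateNorm (R : ℝ) :
    Measurable (truncateNorm R : EuclideanSpace ℝ (Fin n) → EuclideanSpace ℝ (Fin n)) :=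
  Measurable.ite (measurableSet_le measurable_norm measurable_const) measurable_id
    measurable_const

lemma norm_truncateNorm_le {R : ℝ} (hR : 0 ≤ R) (v : EuclideanSpace ℝ (Fin n)) :
    ‖truncateNorm R v‖ ≤ R := by
  unfold truncateNorm
  split_ifs with h
  · exact h
  · simpa using hR

lemma abs_inner_truncateNorm_rpow_le {R : ℝ} (hq : 0 < q) (v x : EuclideanSpace ℝ (Fin n)) :
    |inner ℝ (truncateNorm R v) x| ^ q ≤ |inner ℝ v x| ^ q := by
  unfold truncateNorm
  split_ifs with h
  · exact le_rfl
  · simp only [inner_zero_left, abs_zero, Real.zero_rpow hq.ne']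
    positivity

lemma MarginalMomentBound.truncateNorm (h : MarginalMomentBound μ X q L) (hX : Measurable X)
    (hq : 0 < q) (R : ℝ) : MarginalMomentBound μ (fun ω => truncateNorm R (X ω)) q L := by
  intro x hx
  have hi : Integrable (fun ω => |inner ℝ (_root_.truncateNorm R (X ω)) x| ^ q) μ := by
    refine (h x hx).1.mono' ?_ (ae_of_all _ fun ω => ?_)
    · have : Measurable fun ω => inner ℝ (_root_.truncateNorm R (X ω)) x :=
        ((measurable_truncateNorm R).comp hX).inner_const
      exact (this.abs.pow_const q).aestronglyMeasurable
    · rw [Real.norm_of_nonneg (by positivity)]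
      exact abs_inner_truncateNorm_rpow_le hq _ _
  refine ⟨hi, le_trans ?_ (h x hx).2⟩
  refine Real.rpow_le_rpow (integral_nonneg fun ω => by positivity) ?_ (by positivity)
  exact integral_mono hi (h x hx).1 fun ω => abs_inner_truncateNorm_rpow_le hq _ _

lemma rpow_mul_rpow_three_mul_le {a b : ℝ} (ha : 0 ≤ a) (hb : 0 ≤ b) :
    a ^ p * b ^ (3 * p) ≤ 1 / 4 * a ^ (4 * p) + 3 / 4 * b ^ (4 * p) := by
  have := Real.geom_mean_le_arith_mean2_weighted (w₁ := 1 / 4) (w₂ := 3 / 4)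
    (p₁ := a ^ (4 * p)) (p₂ := b ^ (4 * p)) (by norm_num) (by norm_num) (by positivity)
    (by positivity) (by norm_num)
  rw [← Real.rpow_mul ha, ← Real.rpow_mul hb] at this
  convert this using 3 <;> ring

/-- Pointwise bound for the loss caused by truncating the norm. -/
lemma abs_inner_rpow_sub_truncateNorm_le (hp : 2 < p) (hn : 1 ≤ n) {K : ℝ} (hK : 0 < K)
    (v x : EuclideanSpace ℝ (Fin n)) :
    |inner ℝ v x| ^ p - |inner ℝ (truncateNorm (K * √(n : ℝ)) v) x| ^ p
      ≤ K ^ (p - 4 * p) * ((1 / n) * ∑ j, (1 / 4 * |inner ℝ v x| ^ (4 * p)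
        + 3 / 4 * |inner ℝ v (EuclideanSpace.single j (1 : ℝ))| ^ (4 * p))) := by
  have hp0 : 0 < p := by linarith
  have hn0 : (0 : ℝ) < n := by exact_mod_cast hn
  unfold truncateNorm
  split_ifs with h
  · rw [sub_self]
    positivity
  · push Not at h
    have hv : ∀ j, inner ℝ v (EuclideanSpace.single j (1 : ℝ)) = v j := fun j => by
      simp [EuclideanSpace.inner_single_right]
    simp only [hv, inner_zero_left, abs_zero, Real.zero_rpow hp0.ne', sub_zero]
    set a := |inner ℝ v x|
    have hR : 0 < K * √(n : ℝ) := by positivity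
    -- The excess norm is inserted to the power `3p = q - p`. The power mean inequality then
    -- replaces `‖v‖` by coordinate marginals, the powers of `n` cancel to an average, and weighted
    -- AM-GM restores moments of order `4p`.
    have h1 : 1 ≤ (‖v‖ / (K * √(n : ℝ))) ^ (3 * p) :=
      Real.one_le_rpow ((one_le_div hR).2 h.le) (by positivity)
    have h2 : ‖v‖ ^ (3 * p) ≤ (n : ℝ) ^ (3 * p / 2 - 1) * ∑ j, |v j| ^ (3 * p) := by
      have e1 : ‖v‖ ^ (3 * p) = (∑ j, |v j ^ 2|) ^ (3 * p / 2) := by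
        rw [EuclideanSpace.norm_eq, Real.sqrt_eq_rpow, ← Real.rpow_mul (by positivity)]
        congr 1
        · simp
        · ring
      have e2 : ∀ j, |v j| ^ (3 * p) = |v j ^ 2| ^ (3 * p / 2) := by
        intro j
        rw [abs_pow, ← Real.rpow_natCast, ← Real.rpow_mul (abs_nonneg _)]
        congr 1
        push_cast; ring
      have := Real.rpow_sum_le_const_mul_sum_rpow Finset.univ (fun j => v j ^ 2)
        (p := 3 * p / 2) (by linarith)
      simpa only [e1, e2, Finset.card_univ, Fintype.card_fin] using this
    have h3 : (K * √(n : ℝ)) ^ (3 * p) = K ^ (3 * p) * (n : ℝ) ^ (3 * p / 2) := by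
      rw [Real.mul_rpow hK.le (by positivity), Real.sqrt_eq_rpow, ← Real.rpow_mul hn0.le]
      congr 2; ring
    have h4 : (n : ℝ) ^ (3 * p / 2 - 1) / (n : ℝ) ^ (3 * p / 2) = 1 / n := by
      rw [Real.rpow_sub_one hn0.ne']
      field_simp
    have h5 : K ^ (p - 4 * p) = (K ^ (3 * p))⁻¹ := by
      rw [← Real.rpow_neg hK.le]; congr 1; ring
    calc a ^ p ≤ a ^ p * (‖v‖ / (K * √(n : ℝ))) ^ (3 * p) :=
          le_mul_of_one_le_right (by positivity) h1
      _ = a ^ p * (‖v‖ ^ (3 * p) / (K ^ (3 * p) * (n : ℝ) ^ (3 * p / 2))) := by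
          rw [Real.div_rpow (norm_nonneg _) hR.le, h3]
      _ ≤ a ^ p * ((n : ℝ) ^ (3 * p / 2 - 1) * (∑ j, |v j| ^ (3 * p))
            / (K ^ (3 * p) * (n : ℝ) ^ (3 * p / 2))) := by gcongr
      _ = (K ^ (3 * p))⁻¹ * ((n : ℝ) ^ (3 * p / 2 - 1) / (n : ℝ) ^ (3 * p / 2)
            * ∑ j, a ^ p * |v j| ^ (3 * p)) := by
          rw [← Finset.mul_sum]; field_simp
      _ ≤ _ := by
          rw [h4, h5]
          gcongr with j
          exact rpow_mul_rpow_three_mul_le (abs_nonneg _) (abs_nonneg _)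

lemma MarginalMomentBound.abs_integral_truncateNorm_sub_le [IsProbabilityMeasure μ]
    (h : MarginalMomentBound μ X (4 * p) L) (hX : Measurable X) (hp : 2 < p) (hn : 1 ≤ n) {K : ℝ}
    (hK : 0 < K) {x : EuclideanSpace ℝ (Fin n)} (hx : ‖x‖ = 1) :
    |∫ ω, |inner ℝ (_root_.truncateNorm (K * √(n : ℝ)) (X ω)) x| ^ p ∂μ
      - ∫ ω, |inner ℝ (X ω) x| ^ p ∂μ| ≤ K ^ (p - 4 * p) * L ^ (4 * p) := by
  have hp0 : 0 < p := by linarith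
  have hn0 : (0 : ℝ) < n := by exact_mod_cast hn
  have hi := h.integrable_rpow hX hp0.le (by linarith) hx
  have hi' := (h.truncateNorm hX (by linarith) (K * √(n : ℝ))).integrable_rpow
    ((measurable_truncateNorm _).comp hX) hp0.le (by linarith) hx
  have hs : ∀ j : Fin n, ‖EuclideanSpace.single j (1 : ℝ)‖ = 1 := fun j => by simp
  have hij : ∀ j ∈ Finset.univ, Integrable (fun ω => 1 / 4 * |inner ℝ (X ω) x| ^ (4 * p)
        + 3 / 4 * |inner ℝ (X ω) (EuclideanSpace.single j (1 : ℝ))| ^ (4 * p)) μ := fun j _ =>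
    ((h x hx).1.const_mul _).add ((h _ (hs j)).1.const_mul _)
  rw [abs_sub_comm, ← integral_sub hi hi', abs_of_nonneg (integral_nonneg fun ω =>
    sub_nonneg.2 (abs_inner_truncateNorm_rpow_le hp0 _ _))]
  calc _ ≤ ∫ ω, K ^ (p - 4 * p) * ((1 / n) * ∑ j, (1 / 4 * |inner ℝ (X ω) x| ^ (4 * p)
        + 3 / 4 * |inner ℝ (X ω) (EuclideanSpace.single j (1 : ℝ))| ^ (4 * p))) ∂μ :=
        integral_mono (hi.sub hi') (((integrable_finsetSum _ hij).const_mul _).const_mul _)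
          fun ω => abs_inner_rpow_sub_truncateNorm_le hp hn hK _ _
    _ = K ^ (p - 4 * p) * ((1 / n) * ∑ j : Fin n, (1 / 4 * ∫ ω, |inner ℝ (X ω) x| ^ (4 * p) ∂μ
        + 3 / 4 * ∫ ω, |inner ℝ (X ω) (EuclideanSpace.single j (1 : ℝ))| ^ (4 * p) ∂μ)) := by
        rw [integral_const_mul, integral_const_mul, integral_finsetSum _ hij]
        congr 3
        funext j
        rw [integral_add ((h x hx).1.const_mul _) ((h _ (hs j)).1.const_mul _),
          integral_const_mul, integral_const_mul]
    _ ≤ K ^ (p - 4 * p) * ((1 / n) * ∑ j : Fin n, L ^ (4 * p)) := by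
        gcongr with j
        have h1 := h.integral_le (by linarith) hx
        have h2 := h.integral_le (by linarith) (hs j)
        linarith
    _ = _ := by
        rw [Finset.sum_const, Finset.card_univ, Fintype.card_fin, nsmul_eq_mul]
        field_simp

end Moments

/-! ### Contribution of the large marginals -/

section LargeMarginals

variable {n N d : ℕ} {p W : ℝ} {y : Fin N → EuclideanSpace ℝ (Fin n)}
  {x : EuclideanSpace ℝ (Fin n)}

/-- If `T` were larger, both `N / T.card` and `n / T.card` would be so small that the decay bound
gives at most `W ^ (4 + 4 * e) + W`, below the assumed height. -/
lemma card_mul_pow_le (hp : 2 < p) (hW : 3 ≤ W) {e : ℕ}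
    (hN : W ^ (2 * e + 1) * n ≤ N)
    (hy : ∀ r, 1 ≤ r → r ≤ N →
      AlmostOrthogonal y r (W * (W ^ 3 / 4 * ((N : ℝ) / r) ^ 2) ^ (1 / (4 * p))))
    (hyn : ∀ i, ‖y i‖ ≤ W * √(n : ℝ)) (hx : ‖x‖ = 1) {T : Finset (Fin N)}
    (hT : ∀ i ∈ T, W ^ (5 + 4 * e) ≤ inner ℝ (y i) x) : (T.card : ℝ) * W ^ (2 * e) ≤ N := by
  by_contra! hlt
  have hW0 : 0 < W := by linarith
  rcases T.eq_empty_or_nonempty with rfl | hne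
  · simp only [Finset.card_empty, Nat.cast_zero, zero_mul] at hlt
    exact (Nat.cast_nonneg (α := ℝ) N).not_gt hlt
  have hc : (0 : ℝ) < T.card := by exact_mod_cast hne.card_pos
  have h := le_marginalDecay hp (by linarith) hy hyn hx hne hT
  unfold marginalDecay at h
  have h1 : (N : ℝ) / T.card ≤ W ^ (2 * e) := by
    rw [div_le_iff₀ hc, mul_comm]; exact hlt.le
  have h2 : (W ^ 3 * ((N : ℝ) / T.card) ^ 2) ^ (1 / (4 * p)) ≤ W ^ (3 + 4 * e) := by
    calc (W ^ 3 * ((N : ℝ) / T.card) ^ 2) ^ (1 / (4 * p))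
        ≤ (W ^ 3 * (W ^ (2 * e)) ^ 2) ^ (1 / (4 * p)) := by gcongr
      _ = (W ^ (3 + 4 * e)) ^ (1 / (4 * p)) := by congr 1; ring
      _ ≤ (W ^ (3 + 4 * e)) ^ (1 : ℝ) := by
          refine Real.rpow_le_rpow_of_exponent_le (one_le_pow₀ (by linarith)) ?_
          rw [div_le_one (by linarith)]; linarith
      _ = _ := Real.rpow_one _
  have h3 : 2 * (n : ℝ) / T.card ≤ 1 := by
    rw [div_le_one hc]
    have h4 : W ^ (2 * e) * (W * n) ≤ W ^ (2 * e) * T.card := by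
      calc W ^ (2 * e) * (W * n) = W ^ (2 * e + 1) * n := by ring
        _ ≤ N := hN
        _ ≤ _ := by rw [mul_comm]; exact hlt.le
    have h5 := le_of_mul_le_mul_left h4 (by positivity)
    nlinarith [Nat.cast_nonneg (α := ℝ) n]
  have h4 : √(2 * (n : ℝ) / T.card) ≤ 1 := Real.sqrt_le_one.2 h3
  have h5 : W ^ (5 + 4 * e) ≤ W * W ^ (3 + 4 * e) + W * 1 :=
    h.trans (by gcongr)
  have h6 : 1 ≤ W ^ (3 + 4 * e) := one_le_pow₀ (by linarith)
  have h7 : W ^ (5 + 4 * e) = W * (W * W ^ (3 + 4 * e)) := by ring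
  rw [h7, ← mul_add] at h5
  have h8 := le_of_mul_le_mul_left h5 hW0
  nlinarith

/-- The cardinality bound with `e = d + 6` yields `√(N * T.card) ≤ N / W ^ (d + 6)`. The prefactors
cost at most `W ^ (d + 3)`, which leaves `W ^ 3` in the denominator. -/
lemma sum_large_rpow_le (hp : 2 < p) (hW : 32 ≤ W) (hWp : 2 ^ p ≤ W)
    (hWZ : ∑' m : ℕ, ((m : ℝ) ^ (p / 2))⁻¹ ≤ W) (hpd : p ≤ d)
    (hN : W ^ (d + 6) * (n : ℝ) ^ (p / 2) ≤ N) (hN' : W ^ (2 * (d + 6) + 1) * n ≤ N)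
    (hy : ∀ r, 1 ≤ r → r ≤ N →
      AlmostOrthogonal y r (W * (W ^ 3 / 4 * ((N : ℝ) / r) ^ 2) ^ (1 / (4 * p))))
    (hyn : ∀ i, ‖y i‖ ≤ W * √(n : ℝ)) (hx : ‖x‖ = 1) {T : Finset (Fin N)}
    (hT : ∀ i ∈ T, W ^ (5 + 4 * (d + 6)) ≤ inner ℝ (y i) x) :
    ∑ i ∈ T, (inner ℝ (y i) x) ^ p ≤ 2 * N / W ^ 3 := by
  have hW0 : 0 < W := by linarith
  have hW1 : 1 ≤ W := by linarith
  refine (sum_rpow_inner_le hp hW1 hy hyn hx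
    fun i hi => le_trans (by positivity) (hT i hi)).trans ?_
  have hcard := card_mul_pow_le hp (by linarith) hN' hy hyn hx hT
  have h1 : √(N : ℝ) * √(T.card : ℝ) ≤ N / W ^ (d + 6) := by
    rw [← Real.sqrt_mul (by positivity)]
    refine Real.sqrt_le_iff.2 ⟨by positivity, ?_⟩
    rw [div_pow, le_div_iff₀ (by positivity)]
    calc (N : ℝ) * T.card * (W ^ (d + 6)) ^ 2 = N * (T.card * W ^ (2 * (d + 6))) := by ring
      _ ≤ N * N := by gcongr
      _ = _ := by ring
  have h2 : (2 * (n : ℝ)) ^ (p / 2) ≤ W * (N / W ^ (d + 6)) := by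
    rw [Real.mul_rpow (by norm_num) (by positivity)]
    refine mul_le_mul ?_ ?_ (by positivity) hW0.le
    · exact (Real.rpow_le_rpow_of_exponent_le (by norm_num) (by linarith)).trans hWp
    · rw [le_div_iff₀ (by positivity), mul_comm]; exact hN
  have h3 : W ^ p ≤ W ^ d := by
    rw [← Real.rpow_natCast]; exact Real.rpow_le_rpow_of_exponent_le hW1 hpd
  have h4 : 0 ≤ ∑' m : ℕ, ((m : ℝ) ^ (p / 2))⁻¹ := tsum_nonneg fun _ => by positivity
  calc 2 ^ p * W ^ p * (2 * W * √(N : ℝ) * √(T.card : ℝ)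
      + (2 * n) ^ (p / 2) * ∑' m : ℕ, ((m : ℝ) ^ (p / 2))⁻¹)
      = 2 ^ p * W ^ p * (2 * W * (√(N : ℝ) * √(T.card : ℝ))
      + (2 * n) ^ (p / 2) * ∑' m : ℕ, ((m : ℝ) ^ (p / 2))⁻¹) := by ring
    _ ≤ W * W ^ d * (W * W * (N / W ^ (d + 6)) + W * (N / W ^ (d + 6)) * W) := by
        gcongr
        linarith
    _ = 2 * N / W ^ 3 := by
        field_simp
        ring

/-- Truncating the marginals at a high level hardly changes the empirical `p`-th moments. -/
lemma abs_average_truncatedPower_sub_le (hp : 2 < p) (hW : 32 ≤ W) (hWp : 2 ^ p ≤ W)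
    (hWZ : ∑' m : ℕ, ((m : ℝ) ^ (p / 2))⁻¹ ≤ W) (hpd : p ≤ d) (hN1 : 1 ≤ N)
    (hN : W ^ (d + 6) * (n : ℝ) ^ (p / 2) ≤ N) (hN' : W ^ (2 * (d + 6) + 1) * n ≤ N)
    (hy : ∀ r, 1 ≤ r → r ≤ N →
      AlmostOrthogonal y r (W * (W ^ 3 / 4 * ((N : ℝ) / r) ^ 2) ^ (1 / (4 * p))))
    (hyn : ∀ i, ‖y i‖ ≤ W * √(n : ℝ)) (hx : ‖x‖ = 1) :
    |(1 / (N : ℝ)) * ∑ i, |inner ℝ (y i) x| ^ p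
      - (1 / (N : ℝ)) * ∑ i, truncatedPower p (W ^ (5 + 4 * (d + 6))) (inner ℝ (y i) x)|
      ≤ 4 / W ^ 3 := by
  classical
  have hW0 : 0 < W := by linarith
  have hp0 : 0 < p := by linarith
  have hN0 : (0 : ℝ) < N := by exact_mod_cast hN1
  set M := W ^ (5 + 4 * (d + 6)) with hM
  have hM0 : 0 < M := by positivity
  let T₁ := Finset.univ.filter fun i => M ≤ inner ℝ (y i) x
  -- The one-sided bound at `-x` takes care of the negative marginals.
  let T₂ := Finset.univ.filter fun i => M ≤ inner ℝ (y i) (-x)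
  have h₁ : ∑ i ∈ T₁, (inner ℝ (y i) x) ^ p ≤ 2 * N / W ^ 3 :=
    sum_large_rpow_le hp hW hWp hWZ hpd hN hN' hy hyn hx fun i hi => (Finset.mem_filter.1 hi).2
  have h₂ : ∑ i ∈ T₂, (inner ℝ (y i) (-x)) ^ p ≤ 2 * N / W ^ 3 :=
    sum_large_rpow_le hp hW hWp hWZ hpd hN hN' hy hyn (by rwa [norm_neg])
      fun i hi => (Finset.mem_filter.1 hi).2
  rw [Finset.sum_filter] at h₁ h₂
  have key : ∀ i, |inner ℝ (y i) x| ^ p - truncatedPower p M (inner ℝ (y i) x)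
      ≤ (if M ≤ inner ℝ (y i) x then (inner ℝ (y i) x) ^ p else 0)
        + (if M ≤ inner ℝ (y i) (-x) then (inner ℝ (y i) (-x)) ^ p else 0) := by
    intro i
    have h0 : 0 ≤ truncatedPower p M (inner ℝ (y i) x) :=
      (truncatedPower_mem_Icc hp0.le hM0.le _).1
    rw [inner_neg_right]
    generalize inner ℝ (y i) x = t at h0 ⊢
    rcases le_total |t| M with h | h
    · rw [truncatedPower_of_le h, sub_self]
      refine add_nonneg ?_ ?_ <;> split_ifs with h'
      · exact Real.rpow_nonneg (hM0.le.trans h') _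
      · exact le_rfl
      · exact Real.rpow_nonneg (hM0.le.trans h') _
      · exact le_rfl
    · rcases le_total 0 t with ht | ht
      · rw [abs_of_nonneg ht] at h ⊢
        rw [if_pos h, if_neg (by linarith)]
        linarith
      · rw [abs_of_nonpos ht] at h ⊢
        rw [if_pos h, if_neg (by linarith)]
        linarith
  rw [← mul_sub, ← Finset.sum_sub_distrib, abs_of_nonneg (mul_nonneg (by positivity)
    (Finset.sum_nonneg fun i _ => sub_nonneg.2 (truncatedPower_le hp0.le hM0.le _)))]
  have h3 := Finset.sum_le_sum fun i (_ : i ∈ Finset.univ) => key i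
  rw [Finset.sum_add_distrib] at h3
  calc (1 / (N : ℝ)) * ∑ i, (|inner ℝ (y i) x| ^ p - truncatedPower p M (inner ℝ (y i) x))
      ≤ (1 / (N : ℝ)) * (2 * N / W ^ 3 + 2 * N / W ^ 3) := by
        refine mul_le_mul_of_nonneg_left ?_ (by positivity)
        linarith
    _ = _ := by field_simp; norm_num

end LargeMarginals

/-! ### Probabilities of the bad events -/

section Probability

variable {Ω : Type*} [MeasurableSpace Ω] {μ : Measure Ω} [IsProbabilityMeasure μ] {n N d : ℕ}
  {Y : Fin N → Ω → EuclideanSpace ℝ (Fin n)} {p W : ℝ}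

/-- The level for `r` is tuned so that Markov's inequality at order `4p` gives `τ = 4 / (W³
(N/r)²)`. This cancels the counting factor `(eN/r)²`, and a geometric series in `1/W²` remains. -/
lemma measureReal_exists_not_almostOrthogonal_le (hp : 2 < p) (hW : 32 ≤ W)
    (hY : ∀ i, Measurable (Y i)) (hind : iIndepFun Y μ)
    (hL : ∀ i, MarginalMomentBound μ (Y i) (4 * p) W) :
    μ.real {ω | ∃ r, 1 ≤ r ∧ r ≤ N ∧ ¬ AlmostOrthogonal (fun i => Y i ω) r
      (W * (W ^ 3 / 4 * ((N : ℝ) / r) ^ 2) ^ (1 / (4 * p)))} ≤ 1 / (2 * W) := by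
  have hW0 : 0 < W := by linarith
  have hp0 : 0 < p := by linarith
  let s : ℕ → ℝ := fun r => W * (W ^ 3 / 4 * ((N : ℝ) / r) ^ 2) ^ (1 / (4 * p))
  have hsub : {ω | ∃ r, 1 ≤ r ∧ r ≤ N ∧ ¬ AlmostOrthogonal (fun i => Y i ω) r (s r)}
      ⊆ ⋃ r ∈ Finset.Icc 1 N, {ω | ¬ AlmostOrthogonal (fun i => Y i ω) r (s r)} := by
    rintro ω ⟨r, h1, h2, h3⟩
    simp only [Set.mem_iUnion]
    exact ⟨r, Finset.mem_Icc.2 ⟨h1, h2⟩, h3⟩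
  have hr : ∀ r ∈ Finset.Icc 1 N,
      μ.real {ω | ¬ AlmostOrthogonal (fun i => Y i ω) r (s r)} ≤ (1 / W ^ 2) ^ r := by
    intro r hr
    obtain ⟨h1, h2⟩ := Finset.mem_Icc.1 hr
    have hr0 : (0 : ℝ) < r := by exact_mod_cast h1
    have hN0 : (0 : ℝ) < N := by exact_mod_cast h1.trans h2
    have hA : 0 < W ^ 3 / 4 * ((N : ℝ) / r) ^ 2 := by positivity
    have hs : 0 < s r := by positivity
    refine (measureReal_not_almostOrthogonal_le hY hind (s := s r) (τ := (W / s r) ^ (4 * p))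
      (by positivity) (fun i w => (hL i).measureReal_lt_inner_le (by positivity) hW0.le hs w)
      h1 h2).trans ?_
    refine pow_le_pow_left₀ (by positivity) ?_ r
    have hτ : (W / s r) ^ (4 * p) = (W ^ 3 / 4 * ((N : ℝ) / r) ^ 2)⁻¹ := by
      have : W / s r = ((W ^ 3 / 4 * ((N : ℝ) / r) ^ 2) ^ (1 / (4 * p)))⁻¹ := by
        simp only [s]; field_simp
      rw [this, Real.inv_rpow (by positivity), ← Real.rpow_mul hA.le,
        one_div_mul_cancel (by positivity), Real.rpow_one]
    rw [hτ]
    -- Hence `4 e² ≤ 32 ≤ W`.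
    have he : Real.exp 1 ^ 2 ≤ 8 := by
      have := Real.exp_one_lt_d9
      nlinarith [Real.exp_pos 1]
    calc (Real.exp 1 * N / r) ^ 2 * (W ^ 3 / 4 * ((N : ℝ) / r) ^ 2)⁻¹
        = Real.exp 1 ^ 2 * 4 / W ^ 3 := by field_simp
      _ ≤ W / W ^ 3 := by gcongr; linarith
      _ = 1 / W ^ 2 := by field_simp
  have hθ : 1 / W ^ 2 ≤ 1 / 2 := by
    gcongr; nlinarith
  have hgeom : ∀ k : ℕ, ∑ r ∈ Finset.Icc 1 k, (1 / W ^ 2) ^ r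
      ≤ 2 * (1 / W ^ 2) - 2 * (1 / W ^ 2) * (1 / W ^ 2) ^ k := by
    intro k
    induction k with
    | zero => simp
    | succ k ih =>
      rw [Finset.sum_Icc_succ_top (by omega)]
      have h0 : 0 ≤ (1 / W ^ 2) ^ (k + 1) := by positivity
      have h1 : (1 / W ^ 2) * (1 / W ^ 2) ^ (k + 1) ≤ 1 / 2 * (1 / W ^ 2) ^ (k + 1) := by gcongr
      have h2 : (1 / W ^ 2) * (1 / W ^ 2) ^ k = (1 / W ^ 2) ^ (k + 1) := by ring
      nlinarith
  calc _ ≤ μ.real (⋃ r ∈ Finset.Icc 1 N, {ω | ¬ AlmostOrthogonal (fun i => Y i ω) r (s r)}) :=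
        measureReal_mono hsub (measure_ne_top _ _)
    _ ≤ ∑ r ∈ Finset.Icc 1 N, μ.real {ω | ¬ AlmostOrthogonal (fun i => Y i ω) r (s r)} :=
        measureReal_biUnion_finset_le _ _
    _ ≤ ∑ r ∈ Finset.Icc 1 N, (1 / W ^ 2) ^ r := Finset.sum_le_sum hr
    _ ≤ 2 * (1 / W ^ 2) := by
        have := hgeom N
        have : 0 ≤ 2 * (1 / W ^ 2) * (1 / W ^ 2) ^ N := by positivity
        linarith
    _ ≤ 1 / (2 * W) := by
        rw [mul_one_div, div_le_div_iff₀ (by positivity) (by positivity)]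
        nlinarith

/-- The logarithm of the first factor is `n (H log W + log n)`. From `log n ≤ n ^ a / a` with `a =
p/2 - 1 > 0` it is at most `W² n ^ (p/2)`, one power of `W` less than the exponent it competes with.
-/
lemma pow_mul_exp_neg_le {H : ℕ} (hp : 2 < p) (hW : 32 ≤ W) (hWp : 1 / (p / 2 - 1) ≤ W)
    (hWH : (H : ℝ) + 1 ≤ W) (hn : 1 ≤ n) :
    (W ^ H * n) ^ n * (2 * Real.exp (-(W ^ 3 * (n : ℝ) ^ (p / 2)))) ≤ 1 / (2 * W) := by
  have hW0 : 0 < W := by linarith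
  have hn0 : (0 : ℝ) < n := by exact_mod_cast hn
  have hn1 : (1 : ℝ) ≤ n := by exact_mod_cast hn
  set v := (n : ℝ) ^ (p / 2) with hv
  have hnv : (n : ℝ) ≤ v := by
    calc (n : ℝ) = (n : ℝ) ^ (1 : ℝ) := (Real.rpow_one _).symm
      _ ≤ v := Real.rpow_le_rpow_of_exponent_le hn1 (by linarith)
  have hlogn : n * Real.log n ≤ W * v := by
    have h1 := Real.log_le_rpow_div hn0.le (by linarith : 0 < p / 2 - 1)
    have h2 : (n : ℝ) * (n : ℝ) ^ (p / 2 - 1) = v := by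
      rw [Real.rpow_sub_one hn0.ne', hv]; field_simp
    calc n * Real.log n ≤ n * ((n : ℝ) ^ (p / 2 - 1) / (p / 2 - 1)) := by gcongr
      _ = 1 / (p / 2 - 1) * v := by rw [← h2]; ring
      _ ≤ W * v := by gcongr
  have hlogW : Real.log W ≤ W := (Real.log_le_sub_one_of_pos hW0).trans (by linarith)
  have hlogW0 : 0 ≤ Real.log W := Real.log_nonneg (by linarith)
  have hbase : (W ^ H * n) ^ n = Real.exp (n * (H * Real.log W + Real.log n)) := by
    rw [Real.exp_nat_mul, Real.exp_add, Real.exp_log hn0, Real.exp_nat_mul, Real.exp_log hW0]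
  have hle : n * (H * Real.log W + Real.log n) ≤ W ^ 2 * v := by
    calc n * (H * Real.log W + Real.log n) = H * (n * Real.log W) + n * Real.log n := by ring
      _ ≤ H * (v * W) + W * v := by gcongr
      _ = (H + 1) * W * v := by ring
      _ ≤ W * W * v := by gcongr
      _ = _ := by ring
  calc (W ^ H * n) ^ n * (2 * Real.exp (-(W ^ 3 * v)))
      ≤ Real.exp (W ^ 2 * v) * (2 * Real.exp (-(W ^ 3 * v))) := by
        rw [hbase]; gcongr
    _ = 2 * Real.exp (-((W - 1) * W ^ 2 * v)) := by
        rw [mul_left_comm, ← Real.exp_add]; congr 2; ring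
    _ ≤ 2 * Real.exp (-W ^ 2) := by
        gcongr
        have : 1 ≤ (W - 1) * v := by nlinarith
        nlinarith [sq_nonneg W]
    _ ≤ 2 * (1 / W ^ 2) := by
        rw [Real.exp_neg, one_div]
        gcongr
        linarith [Real.add_one_le_exp (W ^ 2)]
    _ ≤ 1 / (2 * W) := by
        rw [mul_one_div, div_le_div_iff₀ (by positivity) (by positivity)]
        nlinarith

lemma measureReal_exists_truncatedPower_deviation_le {G : ℕ} (hp : 2 < p) (hW : 32 ≤ W)
    (hWp : 1 / (p / 2 - 1) ≤ W) (hpW : p ≤ W) (hWH : (G * d + 8 : ℕ) ≤ W) (hpd : p ≤ d)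
    (hn : 1 ≤ n) (hN1 : 1 ≤ N) (hN : W ^ (7 + 2 * (G * d)) * (n : ℝ) ^ (p / 2) ≤ N)
    (hY : ∀ i, Measurable (Y i)) (hind : iIndepFun Y μ)
    (hYn : ∀ i ω, ‖Y i ω‖ ≤ W * √(n : ℝ)) :
    μ.real {ω | ∃ x : EuclideanSpace ℝ (Fin n), ‖x‖ = 1 ∧
        1 / (4 * W) ≤ |(1 / (N : ℝ)) * ∑ i, truncatedPower p (W ^ G) (inner ℝ (Y i ω) x)
          - (1 / (N : ℝ)) * ∑ i, ∫ ω', truncatedPower p (W ^ G) (inner ℝ (Y i ω') x) ∂μ|}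
      ≤ 1 / (2 * W) := by
  have hW0 : 0 < W := by linarith
  have hW1 : 1 ≤ W := by linarith
  have hp0 : 0 < p := by linarith
  have hn0 : (0 : ℝ) < n := by exact_mod_cast hn
  have hn1 : (1 : ℝ) ≤ n := by exact_mod_cast hn
  have hN0 : (0 : ℝ) < N := by exact_mod_cast hN1
  have hM1 : 1 ≤ W ^ G := one_le_pow₀ hW1
  have hM0 : 0 < W ^ G := by positivity
  have hB : (W ^ G) ^ p ≤ W ^ (G * d) := by
    rw [pow_mul, ← Real.rpow_natCast (W ^ G) d]
    exact Real.rpow_le_rpow_of_exponent_le hM1 hpd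
  have hΛ : p * (W ^ G) ^ (p - 1) ≤ W ^ (G * d + 1) := by
    rw [pow_succ']
    gcongr
    exact (Real.rpow_le_rpow_of_exponent_le hM1 (by linarith)).trans hB
  -- The Lipschitz constant is at most `W ^ (G * d + 1)` and the norms bring one more `W`, so this
  -- mesh makes the discretization error at most `2 / W ^ 3`.
  let k := ⌈W ^ (G * d + 5) * n⌉₊
  have hk : W ^ (G * d + 5) * n ≤ k := Nat.le_ceil _
  have hWn : 1 ≤ W ^ (G * d + 5) * n := one_le_mul_of_one_le_of_one_le (one_le_pow₀ hW1) hn1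
  have hk1 : 1 ≤ k := Nat.one_le_ceil_iff.2 (by linarith)
  have hk0 : (0 : ℝ) < k := by exact_mod_cast hk1
  have hk2 : (k : ℝ) ≤ W ^ (G * d + 5) * n + 1 := (Nat.ceil_lt_add_one (by positivity)).le
  have hk3 : 2 * (k : ℝ) + 1 ≤ W ^ (G * d + 7) * n := by
    have h1 : W ^ (G * d + 7) * n = W ^ 2 * (W ^ (G * d + 5) * n) := by ring
    have h2 : 32 * 32 ≤ W ^ 2 := by nlinarith
    rw [h1]
    generalize W ^ (G * d + 5) * (n : ℝ) = z at hk2 hWn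
    nlinarith
  -- Half of the allowed `1 / (4 * W)` goes to Hoeffding, the other half to the discretization.
  have h := measureReal_exists_deviation_le (u := 1 / (8 * W)) hN1 hY hind hYn
    (measurable_truncatedPower p (W ^ G)) (Real.rpow_pos_of_pos hM0 p)
    (truncatedPower_mem_Icc hp0.le hM0.le) (by positivity)
    (abs_truncatedPower_sub_le (by linarith) hM0.le) (by positivity) hk1
  have herr : 2 * (p * (W ^ G) ^ (p - 1) * (W * √(n : ℝ) * (√(n : ℝ) / k))) ≤ 1 / (8 * W) := by
    have hsq : √(n : ℝ) * √(n : ℝ) = n := Real.mul_self_sqrt hn0.le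
    calc 2 * (p * (W ^ G) ^ (p - 1) * (W * √(n : ℝ) * (√(n : ℝ) / k)))
        = 2 * (p * (W ^ G) ^ (p - 1) * (W * (n / k))) := by
          rw [mul_assoc W, mul_div_assoc', hsq]
      _ ≤ 2 * (W ^ (G * d + 1) * (W * (n / (W ^ (G * d + 5) * n)))) := by gcongr
      _ = 2 / W ^ 3 := by field_simp; ring
      _ ≤ 1 / (8 * W) := by
          rw [div_le_div_iff₀ (by positivity) (by positivity)]
          nlinarith [sq_nonneg W, mul_pos hW0 hW0, mul_pos (mul_pos hW0 hW0) hW0]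
  have hexp : W ^ 3 * (n : ℝ) ^ (p / 2) ≤ 2 * N * (1 / (8 * W)) ^ 2 / ((W ^ G) ^ p) ^ 2 := by
    calc W ^ 3 * (n : ℝ) ^ (p / 2)
        = W ^ (7 + 2 * (G * d)) * (n : ℝ) ^ (p / 2) / (W ^ 4 * (W ^ (G * d)) ^ 2) := by
          field_simp
          ring
      _ ≤ N / (W ^ 4 * (W ^ (G * d)) ^ 2) := by gcongr
      _ ≤ N / (32 * W ^ 2 * ((W ^ G) ^ p) ^ 2) := by
          have h1 : 32 * W ^ 2 ≤ W ^ 4 := by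
            have : (32 : ℝ) ≤ W ^ 2 := by nlinarith
            nlinarith [sq_nonneg W]
          gcongr
      _ = _ := by field_simp; norm_num
  calc _ ≤ _ := by
        refine measureReal_mono ?_ (measure_ne_top _ _)
        rintro ω ⟨x, hx, hω⟩
        refine ⟨x, hx, le_trans ?_ hω⟩
        have : 1 / (4 * W) = 1 / (8 * W) + 1 / (8 * W) := by field_simp; norm_num
        linarith
    _ ≤ _ := h
    _ ≤ (W ^ (G * d + 7) * n) ^ n * (2 * Real.exp (-(W ^ 3 * (n : ℝ) ^ (p / 2)))) := by
        gcongr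
    _ ≤ 1 / (2 * W) := by
        refine pow_mul_exp_neg_le hp hW hWp ?_ hn
        push_cast at hWH ⊢
        linarith

end Probability

/-! ### Assembly -/

/-- Uniform approximation of the `p`-th moments of the marginals of independent bounded random
vectors, with a single parameter `W` for the bounds, the precision and the probability. -/
theorem exists_measureReal_marginal_deviation_le {p : ℝ} (hp : 2 < p) :
    ∃ (W₀ : ℝ) (D : ℕ), 1 ≤ W₀ ∧ ∀ W, W₀ ≤ W → ∀ n N : ℕ, 1 ≤ n → 1 ≤ N →
      W ^ D * (n : ℝ) ^ (p / 2) ≤ N →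
      ∀ {Ω : Type*} [MeasurableSpace Ω] (μ : Measure Ω) [IsProbabilityMeasure μ]
        (Y : Fin N → Ω → EuclideanSpace ℝ (Fin n)),
        (∀ i, Measurable (Y i)) → iIndepFun Y μ → (∀ i ω, ‖Y i ω‖ ≤ W * √(n : ℝ)) →
        (∀ i, MarginalMomentBound μ (Y i) (4 * p) W) →
        μ.real {ω | ∃ x : EuclideanSpace ℝ (Fin n), ‖x‖ = 1 ∧
          1 / W < |(1 / (N : ℝ)) * ∑ i, |inner ℝ (Y i ω) x| ^ p
            - (1 / (N : ℝ)) * ∑ i, ∫ ω', |inner ℝ (Y i ω') x| ^ p ∂μ|} ≤ 1 / W := by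
  have hp0 : 0 < p := by linarith
  obtain ⟨d, hpd⟩ := exists_nat_ge p
  obtain ⟨G, hG⟩ : ∃ G, G = 5 + 4 * (d + 6) := ⟨_, rfl⟩
  have hZ0 : 0 ≤ ∑' m : ℕ, ((m : ℝ) ^ (p / 2))⁻¹ := tsum_nonneg fun _ => by positivity
  have hq0 : 0 ≤ 1 / (p / 2 - 1) := by
    have : 0 < p / 2 - 1 := by linarith
    positivity
  have h2p : (0 : ℝ) ≤ 2 ^ p := by positivity
  have hGd0 : (0 : ℝ) ≤ (G * d + 8 : ℕ) := by positivity
  -- The threshold is a sum of nonnegative terms, so `W` exceeds each of them. The exponent is the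
  -- one Hoeffding's inequality requires; the conditions for the large marginals need less.
  refine ⟨32 + 2 ^ p + ∑' m : ℕ, ((m : ℝ) ^ (p / 2))⁻¹ + p + 1 / (p / 2 - 1)
    + (G * d + 8 : ℕ), 7 + 2 * (G * d), by linarith, ?_⟩
  intro W hW₀ n N hn hN1 hN Ω _ μ _ Y hY hind hYn hL
  have hW : 32 ≤ W := by linarith
  have hW0 : 0 < W := by linarith
  have hW1 : 1 ≤ W := by linarith
  have hn1 : (1 : ℝ) ≤ n := by exact_mod_cast hn
  have hd1 : 1 ≤ d := by
    have : (1 : ℝ) ≤ d := by linarith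
    exact_mod_cast this
  have hGd : G ≤ G * d := Nat.le_mul_of_pos_right G hd1
  have hnv : (n : ℝ) ≤ (n : ℝ) ^ (p / 2) := by
    calc (n : ℝ) = (n : ℝ) ^ (1 : ℝ) := (Real.rpow_one _).symm
      _ ≤ _ := Real.rpow_le_rpow_of_exponent_le hn1 (by linarith)
  have hNd : W ^ (d + 6) * (n : ℝ) ^ (p / 2) ≤ N := by
    refine le_trans ?_ hN
    exact mul_le_mul (pow_le_pow_right₀ hW1 (by omega)) le_rfl
      (by positivity) (by positivity)
  have hNd' : W ^ (2 * (d + 6) + 1) * n ≤ N := by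
    refine le_trans ?_ hN
    exact mul_le_mul (pow_le_pow_right₀ hW1 (by omega)) hnv
      (by positivity) (by positivity)
  have hbad₁ := measureReal_exists_not_almostOrthogonal_le hp hW hY hind hL
  have hbad₂ := measureReal_exists_truncatedPower_deviation_le (G := G) (d := d) hp hW
    (by linarith) (by linarith) (by linarith) hpd hn hN1 hN hY hind hYn
  have hM0 : 0 < W ^ G := by positivity
  have hexp : W ^ (4 * p) * (W ^ G) ^ (p - 4 * p) ≤ 1 / (4 * W) := by
    rw [← Real.rpow_natCast W G, ← Real.rpow_mul hW0.le, ← Real.rpow_add hW0]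
    have hG5 : (5 : ℝ) ≤ G := by exact_mod_cast (by omega : 5 ≤ G)
    calc W ^ (4 * p + G * (p - 4 * p)) ≤ W ^ (-2 : ℝ) := by
          refine Real.rpow_le_rpow_of_exponent_le hW1 ?_
          nlinarith
      _ = 1 / W ^ 2 := by
          rw [Real.rpow_neg hW0.le, one_div]
          norm_num
      _ ≤ _ := by
          rw [div_le_div_iff₀ (by positivity) (by positivity)]
          nlinarith
  have htail : 4 / W ^ 3 ≤ 1 / (4 * W) := by
    rw [div_le_div_iff₀ (by positivity) (by positivity)]
    nlinarith [mul_pos hW0 hW0]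
  have hsum : 1 / W = 1 / (2 * W) + 1 / (2 * W) := by field_simp; norm_num
  have hsum' : 1 / W = 1 / (4 * W) + 1 / (4 * W) + 1 / (4 * W) + 1 / (4 * W) := by
    field_simp; norm_num
  have hW4 : 0 < 1 / (4 * W) := by positivity
  refine le_trans (measureReal_mono (s₂ := _ ∪ _) ?_ (measure_ne_top _ _))
    ((measureReal_union_le _ _).trans ((add_le_add hbad₁ hbad₂).trans hsum.ge))
  rintro ω ⟨x, hx, hω⟩
  by_contra hgood
  simp only [Set.mem_union, Set.mem_ofPred_eq, not_or, not_exists, not_and, not_not, not_le]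
    at hgood
  obtain ⟨h₁, h₂⟩ := hgood
  -- Three errors of at most `1 / (4 * W)` each: the fluctuation of the truncated powers, the large
  -- marginals in the sample, and the truncation bias of the expectations.
  have h₂ := h₂ x hx
  have h₃ := abs_average_truncatedPower_sub_le hp hW (by linarith) (by linarith) hpd hN1 hNd hNd'
    h₁ (fun i => hYn i ω) hx
  rw [← hG] at h₃
  have h₄ := abs_one_div_mul_sum_le hN1 fun i =>
    ((hL i).abs_integral_truncatedPower_sub_le (hY i) hp0 (by linarith) hM0 hx).trans hexp
  rw [Finset.sum_sub_distrib, mul_sub] at h₄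
  rw [abs_lt] at h₂
  rw [abs_le] at h₃ h₄
  rcases lt_abs.1 hω with h | h <;> linarith [h₂.1, h₂.2, h₃.1, h₃.2, h₄.1, h₄.2]

lemma sum_moderateIndices_eq {Ω : Type*} {n N : ℕ} {p : ℝ}
    {X : Fin N → Ω → EuclideanSpace ℝ (Fin n)} (hp : 0 < p) (K : ℝ) (ω : Ω)
    (x : EuclideanSpace ℝ (Fin n)) :
    ∑ i ∈ moderateIndices X K ω, |inner ℝ (X i ω) x| ^ p
      = ∑ i, |inner ℝ (truncateNorm (K * √(n : ℝ)) (X i ω)) x| ^ p := by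
  unfold moderateIndices truncateNorm
  rw [Finset.sum_filter]
  refine Finset.sum_congr rfl fun i _ => ?_
  split_ifs
  · rfl
  · rw [inner_zero_left, abs_zero, Real.zero_rpow hp.ne']

theorem corollary1p5 (p : ℝ) (hp : 2 < p) :
    ∃ P : MvPolynomial (Fin 4) ℝ,
      ∀ K L ε δ : ℝ, 0 < K → 0 ≤ L → 0 < ε → 0 < δ →
        0 < MvPolynomial.eval ![K, L, ε⁻¹, δ⁻¹] P ∧
        ∀ (n N : ℕ),
          MvPolynomial.eval ![K, L, ε⁻¹, δ⁻¹] P * (n : ℝ) ^ (p / 2) ≤ (N : ℝ) →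
          ∀ {Ω : Type*} [MeasurableSpace Ω] (μ : Measure Ω) [IsProbabilityMeasure μ]
            (X : Fin N → Ω → EuclideanSpace ℝ (Fin n)),
            (∀ i, Measurable (X i)) →
            iIndepFun X μ →
            (∀ i, MarginalMomentBound μ (X i) (4 * p) L) →
            1 - δ ≤ μ.real {ω | truncatedDeviation μ X p K ω ≤
              ENNReal.ofReal (ε + K ^ (p - 4 * p) * L ^ (4 * p))} := by
  obtain ⟨W₀, D, hW₀, main⟩ := exists_measureReal_marginal_deviation_le hp
  -- All factors are at least `1`, so the base of the power dominates `W₀`, `K`, `L`, `ε⁻¹` and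
  -- `δ⁻¹` at once.
  refine ⟨(MvPolynomial.C W₀ * ((1 + MvPolynomial.X 0) * (1 + MvPolynomial.X 1)
    * (1 + MvPolynomial.X 2) * (1 + MvPolynomial.X 3))) ^ D, ?_⟩
  intro K L ε δ hK hL hε hδ
  have hp0 : 0 < p := by linarith
  set W := W₀ * ((1 + K) * (1 + L) * (1 + ε⁻¹) * (1 + δ⁻¹)) with hWdef
  have heval : MvPolynomial.eval ![K, L, ε⁻¹, δ⁻¹] ((MvPolynomial.C W₀
      * ((1 + MvPolynomial.X 0) * (1 + MvPolynomial.X 1) * (1 + MvPolynomial.X 2)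
        * (1 + MvPolynomial.X 3))) ^ D) = W ^ D := by
    simp [hWdef]
  rw [heval]
  have hε' : 0 < ε⁻¹ := inv_pos.2 hε
  have hδ' : 0 < δ⁻¹ := inv_pos.2 hδ
  have hW0 : 0 < W := by positivity
  have h1K : 1 ≤ 1 + K := by linarith
  have h1L : 1 ≤ 1 + L := by linarith
  have h1ε : 1 ≤ 1 + ε⁻¹ := by linarith
  have h1δ : 1 ≤ 1 + δ⁻¹ := by linarith
  have hWW₀ : W₀ ≤ W := le_mul_of_one_le_right (by linarith)
    (one_le_mul_of_one_le_of_one_le (one_le_mul_of_one_le_of_one_le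
      (one_le_mul_of_one_le_of_one_le h1K h1L) h1ε) h1δ)
  have hle : ∀ a b c e : ℝ, 1 ≤ a → 1 ≤ b → 1 ≤ c → 1 ≤ e → a ≤ W₀ * (a * b * c * e) := by
    intro a b c e ha hb hc he
    have h := one_le_mul_of_one_le_of_one_le (one_le_mul_of_one_le_of_one_le
      (one_le_mul_of_one_le_of_one_le hW₀ hb) hc) he
    calc a ≤ a * (W₀ * b * c * e) := le_mul_of_one_le_right (by linarith) h
      _ = _ := by ring
  have hKW : K ≤ W := by linarith [hle _ _ _ _ h1K h1L h1ε h1δ]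
  have hLW : L ≤ W := by
    have := hle _ _ _ _ h1L h1K h1ε h1δ
    rw [mul_comm (1 + L)] at this
    linarith
  have hεW : 1 / W ≤ ε := by
    rw [one_div]
    refine inv_le_of_inv_le₀ hε ?_
    have := hle _ _ _ _ h1ε h1K h1L h1δ
    have e : (1 + ε⁻¹) * (1 + K) * (1 + L) = (1 + K) * (1 + L) * (1 + ε⁻¹) := by ring
    rw [e] at this
    linarith
  have hδW : 1 / W ≤ δ := by
    rw [one_div]
    refine inv_le_of_inv_le₀ hδ ?_
    have := hle _ _ _ _ h1δ h1K h1L h1ε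
    have e : (1 + δ⁻¹) * (1 + K) * (1 + L) * (1 + ε⁻¹)
        = (1 + K) * (1 + L) * (1 + ε⁻¹) * (1 + δ⁻¹) := by ring
    rw [e] at this
    linarith
  refine ⟨by positivity, ?_⟩
  intro n N hN Ω _ μ _ X hX hind hmom
  rcases Nat.eq_zero_or_pos n with rfl | hn
  · have huniv : {ω | truncatedDeviation μ X p K ω ≤
        ENNReal.ofReal (ε + K ^ (p - 4 * p) * L ^ (4 * p))} = Set.univ := by
      refine Set.eq_univ_of_forall fun ω => ?_
      change truncatedDeviation μ X p K ω ≤ _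
      refine iSup₂_le fun x hx => ?_
      rw [mem_sphere_zero_iff_norm, Subsingleton.elim x 0, norm_zero] at hx
      exact absurd hx zero_ne_one
    rw [huniv, probReal_univ]
    linarith
  have hn0 : (0 : ℝ) < n := by exact_mod_cast hn
  have hN1 : 1 ≤ N := by
    have : (0 : ℝ) < N := lt_of_lt_of_le (by positivity) hN
    exact_mod_cast this
  have hbad := main W hWW₀ n N hn hN1 hN μ (fun i ω => truncateNorm (K * √(n : ℝ)) (X i ω))
    (fun i => (measurable_truncateNorm _).comp (hX i))
    (hind.comp (fun _ => truncateNorm (K * √(n : ℝ))) fun _ => measurable_truncateNorm _)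
    (fun i ω => (norm_truncateNorm_le (by positivity) _).trans (by gcongr))
    (fun i => ((hmom i).truncateNorm (hX i) (by linarith) _).mono hLW)
  set B := {ω | ∃ x : EuclideanSpace ℝ (Fin n), ‖x‖ = 1 ∧
    1 / W < |(1 / (N : ℝ)) * ∑ i, |inner ℝ (truncateNorm (K * √(n : ℝ)) (X i ω)) x| ^ p
      - (1 / (N : ℝ)) * ∑ i, ∫ ω', |inner ℝ (truncateNorm (K * √(n : ℝ)) (X i ω')) x| ^ p ∂μ|}
  set A := {ω | truncatedDeviation μ X p K ω ≤
    ENNReal.ofReal (ε + K ^ (p - 4 * p) * L ^ (4 * p))}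
  -- A cover and subadditivity replace complements, so neither set has to be measurable.
  have hcover : (Set.univ : Set Ω) ⊆ A ∪ B := by
    intro ω _
    by_cases hω : ω ∈ B
    · exact Or.inr hω
    left
    change truncatedDeviation μ X p K ω ≤ _
    refine iSup₂_le fun x hx => ENNReal.ofReal_le_ofReal ?_
    rw [mem_sphere_zero_iff_norm] at hx
    rw [sum_moderateIndices_eq hp0]
    have h1 := not_lt.1 fun h => hω ⟨x, hx, h⟩
    have h2 := abs_one_div_mul_sum_le hN1 fun i =>
      (hmom i).abs_integral_truncateNorm_sub_le (hX i) hp hn hK hx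
    rw [Finset.sum_sub_distrib, mul_sub] at h2
    refine (abs_sub_le _ _ _).trans (add_le_add (h1.trans hεW) h2)
  have h1 : 1 ≤ μ.real A + μ.real B := by
    calc (1 : ℝ) = μ.real Set.univ := probReal_univ.symm
      _ ≤ μ.real (A ∪ B) := measureReal_mono hcover (measure_ne_top _ _)
      _ ≤ _ := measureReal_union_le _ _
  linarith
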